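/- Let $G$ be a bounded domain in $\mathbb C^n$ ($n\ge 2$), and let $D\Subset G$ (that is, $\overline D$ is a compact subset of $G$) be a domain with $\mathcal C^2$-smooth boundary such that at each boundary point of $D$ the Levi form of $D$, restricted to the complex tangent space, has at least one positive eigenvalue. For a domain $\Omega\subset\mathbb C^n$ let $k_\Omega$ be its Kobayashi distance, i.e. the largest pseudodistance on $\Omega$ not exceeding the Lempert function $$l_\Omega(z,w)=\inf\{\tanh^{-1}|\alpha| : \alpha\in\mathbb D,\ \exists\,\varphi:\mathbb D\to\Omega\text{ holomorphic with }\varphi(0)=z,\ \varphi(\alpha)=w\},$$ where $\mathbb D$ is the unit disc and $\inf\emptyset=\infty$. Then $G'=G\setminus\overline D$ is a domain, $k_G$ and $k_{G'}$ are distances (on $G$ and on $G'$), and $k_{G'}$ is quasi-isometrically equivalent to $k_G|_{G'\times G'}$: there are constants $c_1,c_2>0$ such that $$c_1^{-1}k_{G'}(z,w)-c_2\le k_G(z,w)\le c_1k_{G'}(z,w)+c_2,\qquad z,w\in G'.$$ In particular, if $(G,k_G)$ is Gromov hyperbolic, then so is $(G',k_{G'})$. Here a metric space $(X,d)$ is called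 Gromov hyperbolic if $$\sup_{p,q,x,w\in X}\bigl(\min\{(p,x)_w,(x,q)_w\}-(p,q)_w\bigr)<\infty,\qquad (x,y)_z=d(x,z)+d(z,y)-d(x,y).$$ -/

import Mathlib

open scoped ENNReal

noncomputable section

/-! ### Distances, quasi-isometries and Gromov hyperbolicity -/

/-- `d` is a distance (metric) on `X`. -/
structure IsDistance {X : Type*} (d : X → X → ℝ) : Prop where
  self_eq_zero : ∀ x, d x x = 0
  pos : ∀ x y, x ≠ y → 0 < d x y
  symm : ∀ x y, d x y = d y x
  triangle : ∀ x y z, d x z ≤ d x y + d y z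

/-- `φ : (X, d₁) → (Y, d₂)` is a quasi-isometry (no coarse surjectivity is required). -/
def IsQuasiIsometry {X Y : Type*} (d₁ : X → X → ℝ) (d₂ : Y → Y → ℝ) (φ : X → Y) : Prop :=
  ∃ c₁ c₂ : ℝ, 0 < c₁ ∧ 0 < c₂ ∧ ∀ x y : X,
    c₁⁻¹ * d₁ x y - c₂ ≤ d₂ (φ x) (φ y) ∧ d₂ (φ x) (φ y) ≤ c₁ * d₁ x y + c₂

/-- Two distances on the same set are quasi-isometrically equivalent if the identity map
is a quasi-isometry. -/
def QuasiIsometricallyEquivalent {X : Type*} (d₁ d₂ : X → X → ℝ) : Prop :=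
  IsQuasiIsometry d₁ d₂ id

/-- The Gromov product `(x, y)_z` (without the factor `1 / 2`). -/
def gromovProduct {X : Type*} (d : X → X → ℝ) (x y z : X) : ℝ :=
  d x z + d z y - d x y

/-- `S_d(p, q, x, w) = min {(p, x)_w, (x, q)_w} - (p, q)_w`. -/
def gromovDefect {X : Type*} (d : X → X → ℝ) (p q x w : X) : ℝ :=
  min (gromovProduct d p x w) (gromovProduct d x q w) - gromovProduct d p q w

/-- `(X, d)` is Gromov hyperbolic: the supremum of `S_d` over all quadruples is finite. -/
def IsGromovHyperbolic {X : Type*} (d : X → X → ℝ) : Prop :=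
  ∃ M : ℝ, ∀ p q x w : X, gromovDefect d p q x w ≤ M

/-! ### The Lempert function and the Kobayashi distance -/

/-- The Lempert function of `D`: the infimum of `artanh |α|` over all holomorphic maps `φ` from the
unit disc to `D` with `φ 0 = z` and `φ α = w`, where `α` is in the unit disc. It is `∞` if there is
no such map. -/
def lempertFunction {n : ℕ} (D : Set (EuclideanSpace ℂ (Fin n))) (z w : D) : ℝ≥0∞ :=
  ⨅ (φ : ℂ → EuclideanSpace ℂ (Fin n)) (α : ℂ)
    (_ : DifferentiableOn ℂ φ (Metric.ball 0 1))
    (_ : Set.MapsTo φ (Metric.ball 0 1) D)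
    (_ : α ∈ Metric.ball (0 : ℂ) 1) (_ : φ 0 = z) (_ : φ α = w),
    ENNReal.ofReal (Real.artanh ‖α‖)

/-- The largest pseudodistance on `D`, with values in `[0, ∞]`, that does not exceed the Lempert
function. (All of its values are finite if `D` is a domain.) -/
def kobayashiEDist {n : ℕ} (D : Set (EuclideanSpace ℂ (Fin n))) (z w : D) : ℝ≥0∞ :=
  ⨆ (δ : PseudoMetric D ℝ≥0∞) (_ : ∀ x y : D, δ x y ≤ lempertFunction D x y), δ z w

/-- The Kobayashi distance `k_D` of a domain `D` in `ℂⁿ`. -/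
def kobayashiDist {n : ℕ} (D : Set (EuclideanSpace ℂ (Fin n))) (z w : D) : ℝ :=
  (kobayashiEDist D z w).toReal

/-! ### Smooth boundaries and the Levi form -/

/-- `r` is a `C²` defining function of `D` near the point `p`. -/
def IsC2LocalDefiningFunction {n : ℕ} (D : Set (EuclideanSpace ℂ (Fin n)))
    (r : EuclideanSpace ℂ (Fin n) → ℝ) (p : EuclideanSpace ℂ (Fin n)) : Prop :=
  ∃ U : Set (EuclideanSpace ℂ (Fin n)), IsOpen U ∧ p ∈ U ∧ ContDiffOn ℝ 2 r U ∧
    fderiv ℝ r p ≠ 0 ∧ D ∩ U = {z ∈ U | r z < 0}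

/-- The boundary of `D` is `C²`-smooth. -/
def HasC2Boundary {n : ℕ} (D : Set (EuclideanSpace ℂ (Fin n))) : Prop :=
  ∀ p ∈ frontier D, ∃ r, IsC2LocalDefiningFunction D r p

/-- The complex tangent space at `p` of the level set of `r`: the vectors `X` with
`∑ⱼ ∂r/∂zⱼ(p) Xⱼ = 0`, that is, the maximal complex subspace of the kernel of `dr(p)`. -/
def complexTangentSpace {n : ℕ} (r : EuclideanSpace ℂ (Fin n) → ℝ)
    (p : EuclideanSpace ℂ (Fin n)) : Set (EuclideanSpace ℂ (Fin n)) :=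
  {X | fderiv ℝ r p X = 0 ∧ fderiv ℝ r p (Complex.I • X) = 0}

/-- The sesquilinear form `∑ⱼₖ ∂²r/∂zⱼ∂z̄ₖ(p) Xⱼ Ȳₖ`, written through the real second derivative
`H` of `r` at `p`. It is linear in `X` and conjugate-linear in `Y`. -/
def leviForm {n : ℕ} (r : EuclideanSpace ℂ (Fin n) → ℝ)
    (p X Y : EuclideanSpace ℂ (Fin n)) : ℂ :=
  let H : EuclideanSpace ℂ (Fin n) → EuclideanSpace ℂ (Fin n) → ℝ :=
    fun u v => fderiv ℝ (fderiv ℝ r) p u v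
  (1 / 4 : ℂ) * (((H X Y + H (Complex.I • X) (Complex.I • Y) : ℝ) : ℂ) +
    Complex.I * ((H X (Complex.I • Y) - H (Complex.I • X) Y : ℝ) : ℂ))

/-- The Levi form of `D` at the boundary point `p`, that is, the form `leviForm r p` of a local
defining function `r`, restricted to the complex tangent space, has a positive eigenvalue `μ`.
(A change of the defining function does not change the signs of the eigenvalues.) -/
def LeviFormHasPositiveEigenvalue {n : ℕ} (D : Set (EuclideanSpace ℂ (Fin n)))
    (p : EuclideanSpace ℂ (Fin n)) : Prop :=
  ∃ r, IsC2LocalDefiningFunction D r p ∧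
    ∃ μ : ℝ, 0 < μ ∧ ∃ X ∈ complexTangentSpace r p, X ≠ 0 ∧
      ∀ Y ∈ complexTangentSpace r p, leviForm r p X Y = (μ : ℂ) * inner ℂ Y X

end

/-!
`G \ closure D ⊆ G` gives one inequality, so it suffices to bound the Kobayashi distance of
`G \ closure D` by that of `G` up to an additive constant.

A holomorphic disc of `G` whose centre is at Kobayashi distance at least `ρ` from `closure D`,
restricted to the disc of hyperbolic radius `ρ` and rescaled, is a disc of `G \ closure D`; this
lengthens a short step by a factor `1 + O(e ^ (-2ρ))`. An almost length-minimising chain of short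
steps moves away from `closure D` at least at half of its speed both before and after it comes
close to `closure D`, so that the total excess length is bounded by a convergent integral.

The middle part of the chain is replaced by a chain of bounded length: where the Levi form is
positive in a complex tangent direction, each point outside `closure D` and close to its boundary is
the centre of a quadratic holomorphic disc of fixed size in `G \ closure D`, which leads to a
compact subset of `G \ closure D`. The same discs show that the complement of `closure D` has no
bounded component: at the farthest boundary point of such a component they would leave its closure.
In `ℂⁿ` with `2 ≤ n` the complement of a ball is connected, hence so is that of `closure D`, and
unicoherence of the simply connected space `ℂⁿ` passes this on to `G \ closure D`.
-/

open Set Metric Filter Topology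

/-! ### Hyperbolic trigonometry -/

theorem tanh_add_mul (s t : ℝ) :
    Real.tanh (s + t) * (1 + Real.tanh s * Real.tanh t) = Real.tanh s + Real.tanh t := by
  have hst := (Real.cosh_pos (s + t)).ne'
  rw [Real.cosh_add, mul_comm (Real.cosh s)] at hst
  simp only [Real.tanh_eq_sinh_div_cosh, Real.sinh_add, Real.cosh_add]
  have hs := (Real.cosh_pos s).ne'
  have ht := (Real.cosh_pos t).ne'
  field_simp

theorem abs_tanh_mul_tanh_lt_one (s t : ℝ) : |Real.tanh s * Real.tanh t| < 1 := by
  rw [abs_mul]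
  exact mul_lt_one_of_nonneg_of_lt_one_left (abs_nonneg _) (Real.abs_tanh_lt_one s)
    (Real.abs_tanh_lt_one t).le

theorem tanh_add_eq_div (s t : ℝ) :
    Real.tanh (s + t) = (Real.tanh s + Real.tanh t) / (1 + Real.tanh s * Real.tanh t) := by
  have h := (abs_lt.1 (abs_tanh_mul_tanh_lt_one s t)).1
  exact eq_div_of_mul_eq (by linarith) (tanh_add_mul s t)

theorem tanh_sub_tanh (a b : ℝ) :
    Real.tanh b - Real.tanh a = Real.tanh (b - a) * (1 - Real.tanh a * Real.tanh b) := by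
  have h := tanh_add_mul a (b - a)
  rw [add_sub_cancel] at h
  linear_combination h

theorem tanh_strictMono : StrictMono Real.tanh := by
  intro s t h
  rwa [← Real.artanh_lt_artanh_iff ⟨Real.neg_one_lt_tanh s, Real.tanh_lt_one s⟩
    ⟨Real.neg_one_lt_tanh t, Real.tanh_lt_one t⟩, Real.artanh_tanh, Real.artanh_tanh]

theorem tanh_pos_of_pos {a : ℝ} (ha : 0 < a) : 0 < Real.tanh a :=
  Real.tanh_zero ▸ tanh_strictMono ha

theorem tanh_nonneg_of_nonneg {a : ℝ} (ha : 0 ≤ a) : 0 ≤ Real.tanh a :=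
  Real.tanh_zero ▸ tanh_strictMono.monotone ha

theorem self_le_artanh {s : ℝ} (h0 : 0 ≤ s) (h1 : s < 1) : s ≤ Real.artanh s := by
  have h := Real.sum_range_le_log_div h0 h1 1
  rw [Real.artanh_eq_half_log ⟨by linarith, h1.le⟩]
  simpa using h

theorem artanh_le_two_mul {s : ℝ} (h0 : 0 ≤ s) (h1 : s ≤ 1 / 2) : Real.artanh s ≤ 2 * s := by
  have hs : 0 < 1 - s := by linarith
  have hlog := Real.log_le_sub_one_of_pos (x := (1 + s) / (1 - s)) (by positivity)
  have hdiv : (1 + s) / (1 - s) - 1 ≤ 4 * s := by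
    rw [sub_le_iff_le_add, div_le_iff₀ hs]
    nlinarith
  rw [Real.artanh_eq_half_log ⟨by linarith, by linarith⟩]
  linarith

theorem tanh_le_self {a : ℝ} (ha : 0 ≤ a) : Real.tanh a ≤ a := by
  simpa only [Real.artanh_tanh] using
    self_le_artanh (tanh_nonneg_of_nonneg ha) (Real.tanh_lt_one a)

theorem sub_le_four_mul_tanh_sub_tanh {a b : ℝ} (ha : 0 ≤ a) (hab : a ≤ b)
    (hb : Real.tanh b ≤ 1 / 2) : b - a ≤ 4 * (Real.tanh b - Real.tanh a) := by
  have hτa : 0 ≤ Real.tanh a := tanh_nonneg_of_nonneg ha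
  have hτab : Real.tanh a ≤ Real.tanh b := tanh_strictMono.monotone hab
  have hsub0 : 0 ≤ Real.tanh (b - a) := tanh_nonneg_of_nonneg (sub_nonneg.2 hab)
  have hsub : Real.tanh (b - a) ≤ Real.tanh b := tanh_strictMono.monotone (by linarith)
  have hlin : b - a ≤ 2 * Real.tanh (b - a) := by
    simpa only [Real.artanh_tanh] using artanh_le_two_mul hsub0 (hsub.trans hb)
  have hfac : 1 / 2 ≤ 1 - Real.tanh a * Real.tanh b := by nlinarith
  rw [tanh_sub_tanh]
  nlinarith

theorem artanh_tanh_div_tanh_le {a ρ : ℝ} (ha : 0 ≤ a) (hρ : 0 < ρ)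
    (haρ : Real.tanh a ≤ Real.tanh ρ / 2) :
    Real.artanh (Real.tanh a / Real.tanh ρ) ≤ a * (1 + 4 * ((Real.tanh ρ)⁻¹ - 1)) := by
  have hτ : 0 ≤ Real.tanh a := tanh_nonneg_of_nonneg ha
  have hr : 0 < Real.tanh ρ := tanh_pos_of_pos hρ
  have hquot : Real.tanh a / Real.tanh ρ ≤ 1 / 2 := by
    rw [div_le_iff₀ hr]
    linarith
  have hle : Real.tanh a ≤ Real.tanh a / Real.tanh ρ :=
    le_div_self hτ hr (Real.tanh_lt_one ρ).le
  have htanh : Real.tanh (Real.artanh (Real.tanh a / Real.tanh ρ)) = Real.tanh a / Real.tanh ρ :=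
    Real.tanh_artanh ⟨by linarith, by linarith⟩
  have hab : a ≤ Real.artanh (Real.tanh a / Real.tanh ρ) := by
    rwa [← tanh_strictMono.le_iff_le, htanh]
  have hdiff := sub_le_four_mul_tanh_sub_tanh ha hab (by rwa [htanh])
  have hinv : 0 ≤ (Real.tanh ρ)⁻¹ - 1 :=
    sub_nonneg.2 ((one_le_inv₀ hr).2 (Real.tanh_lt_one ρ).le)
  have hmul := mul_le_mul_of_nonneg_right (tanh_le_self ha) hinv
  rw [htanh] at hdiff
  have hquot_eq : Real.tanh a / Real.tanh ρ = Real.tanh a * (Real.tanh ρ)⁻¹ := div_eq_mul_inv _ _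
  linarith

theorem inv_tanh_sub_one_eq {ρ : ℝ} (hρ : 0 < ρ) :
    (Real.tanh ρ)⁻¹ - 1 = 2 * Real.exp (-2 * ρ) / (1 - Real.exp (-2 * ρ)) := by
  have hlt : Real.exp (-2 * ρ) < 1 := Real.exp_lt_one_iff.2 (by linarith)
  have hexp : Real.exp (-ρ) = Real.exp ρ * Real.exp (-2 * ρ) := by
    rw [← Real.exp_add]
    ring_nf
  have hne : 1 - Real.exp (-2 * ρ) ≠ 0 := by linarith
  rw [Real.tanh_eq, hexp]
  generalize Real.exp (-2 * ρ) = E at *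
  field_simp
  ring

theorem inv_tanh_sub_one_le {ρ₀ ρ : ℝ} (h0 : 0 < ρ₀) (h : ρ₀ ≤ ρ) :
    (Real.tanh ρ)⁻¹ - 1 ≤ 2 / (1 - Real.exp (-2 * ρ₀)) * Real.exp (-2 * ρ) := by
  have hlt : 0 < 1 - Real.exp (-2 * ρ₀) := sub_pos.2 (Real.exp_lt_one_iff.2 (by linarith))
  have hexp : Real.exp (-2 * ρ) ≤ Real.exp (-2 * ρ₀) := Real.exp_le_exp.2 (by linarith)
  rw [inv_tanh_sub_one_eq (h0.trans_le h), mul_div_right_comm]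
  exact mul_le_mul_of_nonneg_right (by gcongr) (Real.exp_pos _).le

/-! ### Holomorphic discs -/

section Disc

variable {E : Type*} [NormedAddCommGroup E] [NormedSpace ℂ E]

/-- A holomorphic disc in `Ω` joins `x` to `y` at hyperbolic distance `a`: the unit of length from
which the Kobayashi pseudodistance is built. The parameter of `y` is normalised to be the real
number `tanh a`. -/
def IsDiscStep (Ω : Set E) (x y : E) (a : ℝ) : Prop :=
  0 ≤ a ∧ ∃ φ : ℂ → E, DifferentiableOn ℂ φ (ball 0 1) ∧ MapsTo φ (ball 0 1) Ω ∧ φ 0 = x ∧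
    φ (Real.tanh a : ℝ) = y

theorem ofReal_tanh_mem_ball (a : ℝ) : ((Real.tanh a : ℝ) : ℂ) ∈ ball (0 : ℂ) 1 := by
  rw [mem_ball_zero_iff, Complex.norm_real]
  exact Real.abs_tanh_lt_one a

theorem norm_ofReal_tanh {a : ℝ} (ha : 0 ≤ a) : ‖((Real.tanh a : ℝ) : ℂ)‖ = Real.tanh a :=
  Complex.norm_of_nonneg (tanh_nonneg_of_nonneg ha)

theorem one_add_mul_ne_zero {u ζ : ℂ} (hu : ‖u‖ < 1) (hζ : ‖ζ‖ < 1) : 1 + u * ζ ≠ 0 := by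
  intro h
  have hlt : ‖u * ζ‖ < 1 := by
    rw [norm_mul]
    exact mul_lt_one_of_nonneg_of_lt_one_left (norm_nonneg u) hu hζ.le
  rw [eq_neg_of_add_eq_zero_right h, norm_neg, norm_one] at hlt
  exact lt_irrefl _ hlt

theorem add_div_one_add_mul_mem_ball {u : ℝ} (hu : |u| < 1) {ζ : ℂ} (hζ : ζ ∈ ball (0 : ℂ) 1) :
    (ζ + u) / (1 + u * ζ) ∈ ball (0 : ℂ) 1 := by
  rw [mem_ball_zero_iff] at hζ ⊢
  have hne : 1 + u * ζ ≠ 0 := one_add_mul_ne_zero (by rwa [Complex.norm_real]) hζ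
  have hζ2 : Complex.normSq ζ < 1 := by
    rw [Complex.normSq_eq_norm_sq]
    exact pow_lt_one₀ (norm_nonneg ζ) hζ two_ne_zero
  have hu2 : u ^ 2 < 1 := (sq_lt_one_iff_abs_lt_one u).2 hu
  rw [norm_div, div_lt_one (norm_pos_iff.2 hne)]
  apply lt_of_pow_lt_pow_left₀ 2 (norm_nonneg _)
  simp only [← Complex.normSq_eq_norm_sq, Complex.normSq_apply, Complex.add_re, Complex.add_im,
    Complex.mul_re, Complex.mul_im, Complex.ofReal_re, Complex.ofReal_im, Complex.one_re,
    Complex.one_im] at hζ2 ⊢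
  nlinarith [mul_pos (sub_pos.2 hζ2) (sub_pos.2 hu2)]

variable {Ω Ω' : Set E} {x y z : E} {a : ℝ}

theorem isDiscStep_tanh {φ : ℂ → E} (hφ : DifferentiableOn ℂ φ (ball 0 1))
    (hm : MapsTo φ (ball 0 1) Ω) {s t : ℝ} (hst : s ≤ t) :
    IsDiscStep Ω (φ (Real.tanh s : ℝ)) (φ (Real.tanh t : ℝ)) (t - s) := by
  have hmob : MapsTo (fun ζ : ℂ => (ζ + (Real.tanh s : ℝ)) / (1 + (Real.tanh s : ℝ) * ζ))
      (ball 0 1) (ball 0 1) := fun ζ => add_div_one_add_mul_mem_ball (Real.abs_tanh_lt_one s)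
  refine ⟨sub_nonneg.2 hst, _, hφ.comp (fun ζ hζ => ?_) hmob, hm.comp hmob, by simp, ?_⟩
  · have hne := one_add_mul_ne_zero (mem_ball_zero_iff.1 (ofReal_tanh_mem_ball s))
      (mem_ball_zero_iff.1 hζ)
    exact DifferentiableAt.differentiableWithinAt (by fun_prop (disch := exact hne))
  · have h := tanh_add_eq_div s (t - s)
    rw [add_sub_cancel] at h
    rw [h, add_comm (Real.tanh s)]
    push_cast
    rfl

theorem isDiscStep_artanh {φ : ℂ → E} (hφ : DifferentiableOn ℂ φ (ball 0 1))
    (hm : MapsTo φ (ball 0 1) Ω) {α : ℂ} (hα : α ∈ ball (0 : ℂ) 1) :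
    IsDiscStep Ω (φ 0) (φ α) (Real.artanh ‖α‖) := by
  obtain ⟨u, hu, huα⟩ : ∃ u : ℂ, ‖u‖ = 1 ∧ u * ‖α‖ = α :=
    ⟨Complex.exp (α.arg * Complex.I), Complex.norm_exp_ofReal_mul_I _, by
      rw [mul_comm, Complex.norm_mul_exp_arg_mul_I]⟩
  have hrot : MapsTo (fun ζ : ℂ => u * ζ) (ball 0 1) (ball 0 1) := fun ζ hζ => by
    simpa [hu] using hζ
  have htanh : Real.tanh (Real.artanh ‖α‖) = ‖α‖ :=
    Real.tanh_artanh ⟨by linarith [norm_nonneg α], by simpa using hα⟩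
  refine ⟨Real.artanh_nonneg (norm_nonneg _), _,
    hφ.comp (differentiable_id.const_mul u).differentiableOn hrot, hm.comp hrot, by simp, ?_⟩
  simp only [Function.comp_apply, htanh, huα]

theorem IsDiscStep.refl (hx : x ∈ Ω) : IsDiscStep Ω x x 0 :=
  ⟨le_rfl, fun _ => x, differentiableOn_const x, fun _ _ => hx, rfl, rfl⟩

theorem IsDiscStep.mem_left (h : IsDiscStep Ω x y a) : x ∈ Ω := by
  obtain ⟨-, φ, -, hm, rfl, -⟩ := h
  exact hm (mem_ball_self one_pos)

theorem IsDiscStep.mem_right (h : IsDiscStep Ω x y a) : y ∈ Ω := by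
  obtain ⟨-, φ, -, hm, -, rfl⟩ := h
  exact hm (ofReal_tanh_mem_ball a)

theorem IsDiscStep.symm (h : IsDiscStep Ω x y a) : IsDiscStep Ω y x a := by
  obtain ⟨ha, φ, hφ, hm, rfl, rfl⟩ := h
  have hneg : MapsTo (fun ζ : ℂ => -ζ) (ball 0 1) (ball 0 1) := fun ζ hζ => by simpa using hζ
  simpa using isDiscStep_tanh (hφ.comp differentiable_id.neg.differentiableOn hneg)
    (hm.comp hneg) (neg_nonpos.2 ha)

theorem IsDiscStep.mono (h : IsDiscStep Ω x y a) (hs : Ω ⊆ Ω') : IsDiscStep Ω' x y a := by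
  obtain ⟨ha, φ, hφ, hm, h0, h1⟩ := h
  exact ⟨ha, φ, hφ, hm.mono_right hs, h0, h1⟩

theorem isDiscStep_of_mem_ball {ρ : ℝ} (hb : ball x ρ ⊆ Ω) (hy : y ∈ ball x ρ) :
    IsDiscStep Ω x y (Real.artanh (dist y x / ρ)) := by
  have hρ : 0 < ρ := pos_of_mem_ball hy
  have hd : dist y x < ρ := hy
  rcases eq_or_ne y x with rfl | hne
  · simpa using IsDiscStep.refl (hb hy)
  have hd0 : 0 < dist y x := dist_pos.2 hne
  have hm : MapsTo (fun ζ : ℂ => x + ζ • ((ρ / dist y x : ℝ) : ℂ) • (y - x)) (ball 0 1) Ω := by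
    intro ζ hζ
    apply hb
    rw [mem_ball_zero_iff] at hζ
    rw [mem_ball_iff_norm, add_sub_cancel_left, norm_smul, norm_smul, ← dist_eq_norm,
      Complex.norm_of_nonneg (by positivity), div_mul_cancel₀ _ hd0.ne']
    exact mul_lt_of_lt_one_left hρ hζ
  have hα : ‖((dist y x / ρ : ℝ) : ℂ)‖ = dist y x / ρ := Complex.norm_of_nonneg (by positivity)
  have hα1 : ((dist y x / ρ : ℝ) : ℂ) ∈ ball (0 : ℂ) 1 := by
    rwa [mem_ball_zero_iff, hα, div_lt_one hρ]
  have h := isDiscStep_artanh (Differentiable.differentiableOn (by fun_prop)) hm hα1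
  rwa [zero_smul, add_zero, hα, smul_smul, ← Complex.ofReal_mul,
    div_mul_div_cancel₀ hρ.ne', div_self hd0.ne', Complex.ofReal_one, one_smul,
    add_sub_cancel] at h

/-! ### Chains of discs -/

variable {ε S T : ℝ}

/-- `z` is reached from `x` by a chain of disc steps of lengths at most `ε` and of total
length `T`. -/
inductive DiscChain (Ω : Set E) (ε : ℝ) (x : E) : E → ℝ → Prop
  | nil (hx : x ∈ Ω) : DiscChain Ω ε x x 0
  | snoc {y z : E} {T a : ℝ} (h : DiscChain Ω ε x y T) (hs : IsDiscStep Ω y z a) (ha : a ≤ ε) :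
      DiscChain Ω ε x z (T + a)

theorem DiscChain.nonneg (h : DiscChain Ω ε x y T) : 0 ≤ T := by
  induction h with
  | nil => exact le_rfl
  | snoc _ hs _ ih => exact add_nonneg ih hs.1

theorem DiscChain.trans (h : DiscChain Ω ε x y S) (h' : DiscChain Ω ε y z T) :
    DiscChain Ω ε x z (S + T) := by
  induction h' with
  | nil => simpa using h
  | snoc _ hs ha ih => simpa only [add_assoc] using ih.snoc hs ha

theorem DiscChain.symm (h : DiscChain Ω ε x y T) : DiscChain Ω ε y x T := by
  induction h with
  | nil hx => exact .nil hx
  | @snoc y z T a _ hs ha ih =>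
    have hzy : DiscChain Ω ε z y a := by simpa using (DiscChain.nil hs.mem_right).snoc hs.symm ha
    simpa only [add_comm] using hzy.trans ih

theorem IsDiscStep.discChain (h : IsDiscStep Ω x y a) (hε : 0 < ε) : DiscChain Ω ε x y a := by
  obtain ⟨ha, φ, hφ, hm, rfl, rfl⟩ := h
  obtain ⟨N, hN⟩ := exists_nat_gt (a / ε)
  have hN0 : (0 : ℝ) < N := (div_nonneg ha hε.le).trans_lt hN
  have hshort : a / N ≤ ε := ((div_lt_comm₀ hε hN0).1 hN).le
  have hsteps : ∀ k : ℕ,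
      DiscChain Ω ε (φ 0) (φ (Real.tanh (k * (a / N)) : ℝ)) (k * (a / N)) := by
    intro k
    induction k with
    | zero => simpa using DiscChain.nil (hm (mem_ball_self one_pos))
    | succ k ih =>
      have hlen : ((k + 1 : ℕ) : ℝ) * (a / N) = k * (a / N) + a / N := by push_cast; ring
      have hstep := isDiscStep_tanh hφ hm
        (le_add_of_nonneg_right (a := k * (a / N)) (by positivity : 0 ≤ a / N))
      rw [add_sub_cancel_left] at hstep
      rw [hlen]
      exact ih.snoc hstep hshort
  simpa only [mul_div_cancel₀ _ hN0.ne'] using hsteps N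

/-- The pseudodistance given by the infimal length of chains of short discs. -/
noncomputable def discChainPseudoMetric (Ω : Set E) (ε : ℝ) : PseudoMetric Ω ℝ≥0∞ where
  toFun x y := ⨅ (T : ℝ) (_ : DiscChain Ω ε (x : E) y T), ENNReal.ofReal T
  refl' x := le_antisymm (iInf₂_le_of_le 0 (.nil x.2) (by simp)) zero_le
  symm' x y := iInf_congr fun T => iInf_congr_Prop ⟨DiscChain.symm, DiscChain.symm⟩ fun _ => rfl
  triangle' x y z := by
    simp only [ENNReal.iInf_add, ENNReal.add_iInf, le_iInf_iff]
    intro T hT S hS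
    rw [← ENNReal.ofReal_add hS.nonneg hT.nonneg]
    exact iInf₂_le_of_le _ (hS.trans hT) le_rfl

/-- A chain of discs as a sequence of points `p i` with partial sums `S i` of lengths. Finite
chains are prolonged by constant sequences. -/
def IsDiscSeq (Ω : Set E) (ε : ℝ) (p : ℕ → Ω) (S : ℕ → ℝ) : Prop :=
  ∀ i, IsDiscStep Ω (p i : E) (p (i + 1)) (S (i + 1) - S i) ∧ S (i + 1) - S i ≤ ε

theorem DiscChain.exists_isDiscSeq (h : DiscChain Ω ε x y T) (hε : 0 ≤ ε) :
    ∃ (N : ℕ) (p : ℕ → Ω) (S : ℕ → ℝ), IsDiscSeq Ω ε p S ∧ (p 0 : E) = x ∧ (p N : E) = y ∧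
      S N - S 0 = T := by
  induction h with
  | nil hx => exact ⟨0, fun _ => ⟨x, hx⟩, fun _ => 0, fun _ => by
      simpa using ⟨IsDiscStep.refl hx, hε⟩, rfl, rfl, sub_self 0⟩
  | @snoc y z T a _ hs ha ih =>
    obtain ⟨N, p, S, h, h0, rfl, rfl⟩ := ih
    refine ⟨N + 1, fun i => if i ≤ N then p i else ⟨z, hs.mem_right⟩,
      fun i => if i ≤ N then S i else S N + a, fun i => ?_, by simpa using h0, by simp, ?_⟩
    · rcases lt_trichotomy i N with hi | rfl | hi
      · have hi' : i + 1 ≤ N := hi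
        simpa only [hi.le, hi', if_true] using h i
      · simpa using ⟨hs, ha⟩
      · have hi' : ¬ i + 1 ≤ N := by omega
        simpa [hi.not_ge, hi'] using ⟨IsDiscStep.refl hs.mem_right, hε⟩
    · simp only [zero_le, if_true, add_le_iff_nonpos_right, nonpos_iff_eq_zero, one_ne_zero,
        if_false]
      ring

variable {p : ℕ → Ω} {s : ℕ → ℝ}

theorem IsDiscSeq.monotone (h : IsDiscSeq Ω ε p s) : Monotone s :=
  monotone_nat_of_le_succ fun i => sub_nonneg.1 (h i).1.1

theorem IsDiscSeq.shift (h : IsDiscSeq Ω ε p s) (k : ℕ) :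
    IsDiscSeq Ω ε (fun i => p (k + i)) (fun i => s (k + i)) :=
  fun i => h (k + i)

theorem IsDiscSeq.reverse (h : IsDiscSeq Ω ε p s) (hε : 0 ≤ ε) (k : ℕ) :
    IsDiscSeq Ω ε (fun i => p (k - i)) (fun i => -s (k - i)) := by
  intro i
  rcases lt_or_ge i k with hik | hki
  · have hpred : k - (i + 1) + 1 = k - i := by omega
    obtain ⟨hs, ha⟩ := h (k - (i + 1))
    rw [hpred] at hs ha
    rw [neg_sub_neg]
    exact ⟨hs.symm, ha⟩
  · have hi : k - i = 0 := by omega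
    have hi' : k - (i + 1) = 0 := by omega
    simpa only [hi, hi', sub_self] using ⟨IsDiscStep.refl (p 0).2, hε⟩

end Disc

/-! ### The Kobayashi distance -/

section Kobayashi

variable {n : ℕ} {Ω Ω' : Set (EuclideanSpace ℂ (Fin n))}

theorem le_kobayashiEDist (δ : PseudoMetric Ω ℝ≥0∞)
    (h : ∀ (x y : Ω) (a : ℝ), IsDiscStep Ω (x : EuclideanSpace ℂ (Fin n)) y a →
      δ x y ≤ ENNReal.ofReal a) (x y : Ω) : δ x y ≤ kobayashiEDist Ω x y := by
  refine le_iSup₂_of_le (f := fun (δ : PseudoMetric Ω ℝ≥0∞)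
    (_ : ∀ x y : Ω, δ x y ≤ lempertFunction Ω x y) => δ x y) δ (fun x y => ?_) le_rfl
  simp only [lempertFunction, le_iInf_iff]
  intro φ α hφ hm hα h0 h1
  exact h x y _ (h0 ▸ h1 ▸ isDiscStep_artanh hφ hm hα)

theorem kobayashiEDist_self (x : Ω) : kobayashiEDist Ω x x = 0 := by
  simp [kobayashiEDist]

theorem kobayashiEDist_comm (x y : Ω) : kobayashiEDist Ω x y = kobayashiEDist Ω y x :=
  iSup_congr fun δ => iSup_congr fun _ => δ.symm x y

theorem kobayashiEDist_triangle (x y z : Ω) :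
    kobayashiEDist Ω x z ≤ kobayashiEDist Ω x y + kobayashiEDist Ω y z := by
  have hle (δ : PseudoMetric Ω ℝ≥0∞) (h : ∀ x y : Ω, δ x y ≤ lempertFunction Ω x y) (x y : Ω) :
      δ x y ≤ kobayashiEDist Ω x y :=
    le_iSup₂ (f := fun (δ : PseudoMetric Ω ℝ≥0∞)
      (_ : ∀ x y : Ω, δ x y ≤ lempertFunction Ω x y) => δ x y) δ h
  exact iSup₂_le fun δ h => (δ.triangle x y z).trans (add_le_add (hle δ h x y) (hle δ h y z))

theorem IsDiscStep.kobayashiEDist_le {x y : Ω} {a : ℝ}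
    (h : IsDiscStep Ω (x : EuclideanSpace ℂ (Fin n)) y a) :
    kobayashiEDist Ω x y ≤ ENNReal.ofReal a := by
  obtain ⟨ha, φ, hφ, hm, h0, h1⟩ := h
  refine (iSup₂_le fun _ hδ => hδ x y : kobayashiEDist Ω x y ≤ lempertFunction Ω x y).trans ?_
  refine iInf_le_of_le φ (iInf_le_of_le (Real.tanh a : ℝ) (iInf_le_of_le hφ (iInf_le_of_le hm
    (iInf_le_of_le (ofReal_tanh_mem_ball a) (iInf_le_of_le h0 (iInf_le_of_le h1 ?_))))))
  rw [norm_ofReal_tanh ha, Real.artanh_tanh]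

theorem kobayashiEDist_mono (hs : Ω ⊆ Ω') (x y : Ω) :
    kobayashiEDist Ω' (inclusion hs x) (inclusion hs y) ≤ kobayashiEDist Ω x y := by
  let δ : PseudoMetric Ω ℝ≥0∞ :=
    { toFun := fun x y => kobayashiEDist Ω' (inclusion hs x) (inclusion hs y)
      refl' := fun _ => kobayashiEDist_self _
      symm' := fun _ _ => kobayashiEDist_comm _ _
      triangle' := fun _ _ _ => kobayashiEDist_triangle _ _ _ }
  exact le_kobayashiEDist δ (fun x y a h => (h.mono hs).kobayashiEDist_le) x y

theorem exists_discChain_of_kobayashiEDist_lt {ε : ℝ} (hε : 0 < ε) {x y : Ω} {c : ℝ≥0∞}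
    (h : kobayashiEDist Ω x y < c) :
    ∃ T : ℝ, DiscChain Ω ε (x : EuclideanSpace ℂ (Fin n)) y T ∧ ENNReal.ofReal T < c := by
  have hle : discChainPseudoMetric Ω ε x y ≤ kobayashiEDist Ω x y :=
    le_kobayashiEDist _ (fun x y a hs => iInf₂_le_of_le a (hs.discChain hε) le_rfl) x y
  obtain ⟨T, hT⟩ := iInf_lt_iff.1 (hle.trans_lt h)
  obtain ⟨hchain, hTc⟩ := iInf_lt_iff.1 hT
  exact ⟨T, hchain, hTc⟩

/-- `x` and `y` lie in `Ω`, at Kobayashi distance at most `T`. Membership and `0 ≤ T` are part of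
the notion, so that such bounds can be added up without side conditions. -/
def KobayashiLE (Ω : Set (EuclideanSpace ℂ (Fin n))) (x y : EuclideanSpace ℂ (Fin n))
    (T : ℝ) : Prop :=
  0 ≤ T ∧ ∃ (hx : x ∈ Ω) (hy : y ∈ Ω), kobayashiEDist Ω ⟨x, hx⟩ ⟨y, hy⟩ ≤ ENNReal.ofReal T

variable {x y z : EuclideanSpace ℂ (Fin n)} {S T : ℝ}

theorem IsDiscStep.kobayashiLE (h : IsDiscStep Ω x y T) : KobayashiLE Ω x y T :=
  ⟨h.1, h.mem_left, h.mem_right, h.kobayashiEDist_le⟩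

theorem KobayashiLE.refl (hx : x ∈ Ω) : KobayashiLE Ω x x 0 :=
  ⟨le_rfl, hx, hx, (kobayashiEDist_self _).trans_le zero_le⟩

theorem KobayashiLE.symm (h : KobayashiLE Ω x y T) : KobayashiLE Ω y x T := by
  obtain ⟨hT, hx, hy, h⟩ := h
  exact ⟨hT, hy, hx, by rwa [kobayashiEDist_comm]⟩

theorem KobayashiLE.mono (h : KobayashiLE Ω x y S) (hST : S ≤ T) : KobayashiLE Ω x y T := by
  obtain ⟨hS, hx, hy, h⟩ := h
  exact ⟨hS.trans hST, hx, hy, h.trans (ENNReal.ofReal_le_ofReal hST)⟩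

theorem KobayashiLE.trans (h : KobayashiLE Ω x y S) (h' : KobayashiLE Ω y z T) :
    KobayashiLE Ω x z (S + T) := by
  obtain ⟨hS, hx, hy, h⟩ := h
  obtain ⟨hT, _, hz, h'⟩ := h'
  refine ⟨add_nonneg hS hT, hx, hz, (kobayashiEDist_triangle _ ⟨y, hy⟩ _).trans ?_⟩
  rw [ENNReal.ofReal_add hS hT]
  exact add_le_add h h'

theorem KobayashiLE.sum {p : ℕ → EuclideanSpace ℂ (Fin n)} {c : ℕ → ℝ} {N : ℕ} (h0 : p 0 ∈ Ω)
    (h : ∀ i < N, KobayashiLE Ω (p i) (p (i + 1)) (c i)) :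
    KobayashiLE Ω (p 0) (p N) (∑ i ∈ Finset.range N, c i) := by
  induction N with
  | zero => simpa using KobayashiLE.refl h0
  | succ N ih =>
    rw [Finset.sum_range_succ]
    exact (ih fun i hi => h i (by omega)).trans (h N (by omega))

theorem KobayashiLE.kobayashiDist_le {x y : Ω}
    (h : KobayashiLE Ω (x : EuclideanSpace ℂ (Fin n)) y T) : kobayashiDist Ω x y ≤ T :=
  ENNReal.toReal_le_of_le_ofReal h.1 h.2.2.2

/-- `S` lies in a ball of finite radius around `o` for the Kobayashi distance of `Ω`. -/
def IsKobayashiBounded (Ω : Set (EuclideanSpace ℂ (Fin n))) (o : EuclideanSpace ℂ (Fin n))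
    (S : Set (EuclideanSpace ℂ (Fin n))) : Prop :=
  ∃ R, ∀ x ∈ S, KobayashiLE Ω o x R

section Bounded

variable {o : EuclideanSpace ℂ (Fin n)} {A B L : Set (EuclideanSpace ℂ (Fin n))}

theorem IsKobayashiBounded.mono (h : IsKobayashiBounded Ω o B) (hAB : A ⊆ B) :
    IsKobayashiBounded Ω o A :=
  h.imp fun _ hR x hx => hR x (hAB hx)

theorem IsKobayashiBounded.union (hA : IsKobayashiBounded Ω o A)
    (hB : IsKobayashiBounded Ω o B) : IsKobayashiBounded Ω o (A ∪ B) := by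
  obtain ⟨R, hR⟩ := hA
  obtain ⟨R', hR'⟩ := hB
  refine ⟨max R R', fun x hx => hx.elim (fun hx => ?_) fun hx => ?_⟩
  · exact (hR x hx).mono (le_max_left _ _)
  · exact (hR' x hx).mono (le_max_right _ _)

theorem isKobayashiBounded_inter_of_isCompact (hL : IsCompact L)
    (h : ∀ p ∈ L, ∃ U ∈ 𝓝 p, IsKobayashiBounded Ω o (U ∩ A)) :
    IsKobayashiBounded Ω o (L ∩ A) := by
  refine hL.induction_on (p := fun L => IsKobayashiBounded Ω o (L ∩ A)) ⟨0, by simp⟩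
    (fun s t hst ht => ht.mono (inter_subset_inter_left A hst))
    (fun s t hs ht => union_inter_distrib_right s t A ▸ hs.union ht) fun p hp => ?_
  obtain ⟨U, hU, hb⟩ := h p hp
  exact ⟨U, mem_nhdsWithin_of_mem_nhds hU, hb⟩

end Bounded

theorem kobayashiLE_of_mem_ball_half {ρ : ℝ} (hb : ball x ρ ⊆ Ω) (hy : y ∈ ball x (ρ / 2)) :
    KobayashiLE Ω x y (Real.artanh (1 / 2)) := by
  have hρ : 0 < ρ := by linarith [pos_of_mem_ball hy]
  have hq : dist y x / ρ ≤ 1 / 2 := by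
    rw [div_le_iff₀ hρ]
    linarith [mem_ball.1 hy]
  have hq0 : 0 ≤ dist y x / ρ := by positivity
  exact (isDiscStep_of_mem_ball hb (ball_subset_ball (half_le_self hρ.le) hy)).kobayashiLE.mono
    (Real.artanh_le_artanh (by linarith) (by norm_num) hq)

theorem exists_kobayashiLE (ho : IsOpen Ω) (hc : IsPreconnected Ω) (hx : x ∈ Ω) (hy : y ∈ Ω) :
    ∃ T, KobayashiLE Ω x y T := by
  refine hc.induction₂ (fun x y => ∃ T, KobayashiLE Ω x y T) (fun x hx => ?_) ?_ ?_ hx hy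
  · obtain ⟨ρ, hρ, hb⟩ := Metric.isOpen_iff.1 ho x hx
    filter_upwards [mem_nhdsWithin_of_mem_nhds (ball_mem_nhds x (half_pos hρ))] with y hy
    exact ⟨_, kobayashiLE_of_mem_ball_half hb hy⟩
  · rintro x y z _ _ _ ⟨T, h⟩ ⟨S, h'⟩
    exact ⟨_, h.trans h'⟩
  · rintro x y _ _ ⟨T, h⟩
    exact ⟨T, h.symm⟩

theorem exists_nhds_isKobayashiBounded (ho : IsOpen Ω) (hc : IsPreconnected Ω) (hx : x ∈ Ω)
    (hy : y ∈ Ω) : ∃ U ∈ 𝓝 y, IsKobayashiBounded Ω x U := by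
  obtain ⟨ρ, hρ, hb⟩ := Metric.isOpen_iff.1 ho y hy
  obtain ⟨T, hT⟩ := exists_kobayashiLE ho hc hx hy
  exact ⟨ball y (ρ / 2), ball_mem_nhds y (half_pos hρ), _, fun z hz =>
    hT.trans (kobayashiLE_of_mem_ball_half hb hz)⟩

theorem isKobayashiBounded_of_isCompact (ho : IsOpen Ω) (hc : IsPreconnected Ω) (hx : x ∈ Ω)
    {Q : Set (EuclideanSpace ℂ (Fin n))} (hQ : IsCompact Q) (hQΩ : Q ⊆ Ω) :
    IsKobayashiBounded Ω x Q := by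
  rw [← inter_univ Q]
  refine isKobayashiBounded_inter_of_isCompact hQ fun y hy => ?_
  simpa only [inter_univ] using exists_nhds_isKobayashiBounded ho hc hx (hQΩ hy)

theorem exists_ofReal_mul_dist_le_kobayashiEDist (hb : Bornology.IsBounded Ω) :
    ∃ c > 0, ∀ x y : Ω, ENNReal.ofReal (c * dist x y) ≤ kobayashiEDist Ω x y := by
  obtain ⟨R, hR, hRb⟩ : ∃ R > 0, ∀ x ∈ Ω, ∀ y ∈ Ω, dist x y ≤ R := by
    obtain ⟨R, hR⟩ := isBounded_iff.1 hb
    exact ⟨max R 1, by positivity, fun x hx y hy => le_max_of_le_left (hR hx hy)⟩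
  let δ : PseudoMetric Ω ℝ≥0∞ :=
    { toFun := fun x y => ENNReal.ofReal (R⁻¹ * dist x y)
      refl' := fun _ => by simp
      symm' := fun x y => by rw [dist_comm]
      triangle' := fun x y z => by
        rw [← ENNReal.ofReal_add (by positivity) (by positivity), ← mul_add]
        exact ENNReal.ofReal_le_ofReal (by gcongr; exact dist_triangle _ _ _) }
  refine ⟨R⁻¹, inv_pos.2 hR, le_kobayashiEDist δ ?_⟩
  rintro x y a ⟨ha, φ, hφ, hm, h0, h1⟩
  have hmR : MapsTo φ (ball 0 1) (closedBall (φ 0) R) := fun ζ hζ =>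
    mem_closedBall.2 (hRb _ (hm hζ) _ (hm (mem_ball_self one_pos)))
  have hschwarz := Complex.dist_le_div_mul_dist_of_mapsTo_ball hφ hmR (ofReal_tanh_mem_ball a)
  rw [h0, h1, dist_zero_right, norm_ofReal_tanh ha, div_one] at hschwarz
  refine ENNReal.ofReal_le_ofReal ?_
  rw [Subtype.dist_eq, dist_comm, inv_mul_le_iff₀ hR]
  exact hschwarz.trans (by gcongr; exact tanh_le_self ha)

theorem kobayashiDist_nonneg (x y : Ω) : 0 ≤ kobayashiDist Ω x y := ENNReal.toReal_nonneg

theorem kobayashiDist_comm (x y : Ω) : kobayashiDist Ω x y = kobayashiDist Ω y x := by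
  rw [kobayashiDist, kobayashiEDist_comm, kobayashiDist]

theorem kobayashiEDist_ne_top (ho : IsOpen Ω) (hc : IsPreconnected Ω) (x y : Ω) :
    kobayashiEDist Ω x y ≠ ⊤ := by
  obtain ⟨T, _, _, _, h⟩ := exists_kobayashiLE ho hc x.2 y.2
  exact ne_top_of_le_ne_top ENNReal.ofReal_ne_top h

theorem kobayashiLE_kobayashiDist (ho : IsOpen Ω) (hc : IsPreconnected Ω) (x y : Ω) :
    KobayashiLE Ω (x : EuclideanSpace ℂ (Fin n)) y (kobayashiDist Ω x y) :=
  ⟨kobayashiDist_nonneg x y, x.2, y.2,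
    (ENNReal.ofReal_toReal (kobayashiEDist_ne_top ho hc x y)).ge⟩

theorem kobayashiDist_triangle (ho : IsOpen Ω) (hc : IsPreconnected Ω) (x y z : Ω) :
    kobayashiDist Ω x z ≤ kobayashiDist Ω x y + kobayashiDist Ω y z :=
  ((kobayashiLE_kobayashiDist ho hc x y).trans
    (kobayashiLE_kobayashiDist ho hc y z)).kobayashiDist_le

theorem kobayashiDist_inclusion_le (ho : IsOpen Ω) (hc : IsPreconnected Ω) (hs : Ω ⊆ Ω')
    (x y : Ω) : kobayashiDist Ω' (inclusion hs x) (inclusion hs y) ≤ kobayashiDist Ω x y :=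
  ENNReal.toReal_mono (kobayashiEDist_ne_top ho hc x y) (kobayashiEDist_mono hs x y)

theorem exists_mul_dist_le_kobayashiDist (ho : IsOpen Ω) (hc : IsPreconnected Ω)
    (hb : Bornology.IsBounded Ω) : ∃ c > 0, ∀ x y : Ω, c * dist x y ≤ kobayashiDist Ω x y :=
  (exists_ofReal_mul_dist_le_kobayashiEDist hb).imp fun _ h => ⟨h.1, fun x y =>
    (ENNReal.ofReal_le_iff_le_toReal (kobayashiEDist_ne_top ho hc x y)).1 (h.2 x y)⟩

theorem isDistance_kobayashiDist (ho : IsOpen Ω) (hc : IsPreconnected Ω)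
    (hb : Bornology.IsBounded Ω) : IsDistance (kobayashiDist Ω) where
  self_eq_zero x := by rw [kobayashiDist, kobayashiEDist_self, ENNReal.toReal_zero]
  pos x y hxy := by
    obtain ⟨c, hc0, h⟩ := exists_mul_dist_le_kobayashiDist ho hc hb
    exact (mul_pos hc0 (dist_pos.2 hxy)).trans_le (h x y)
  symm := kobayashiDist_comm
  triangle := kobayashiDist_triangle ho hc

theorem exists_isDiscSeq_lt {ε : ℝ} (hε : 0 < ε) (ho : IsOpen Ω) (hc : IsPreconnected Ω)
    (x y : Ω) : ∃ (N : ℕ) (p : ℕ → Ω) (S : ℕ → ℝ), IsDiscSeq Ω ε p S ∧ p 0 = x ∧ p N = y ∧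
      S N - S 0 < kobayashiDist Ω x y + 1 := by
  have hlt : kobayashiEDist Ω x y < ENNReal.ofReal (kobayashiDist Ω x y + 1) := by
    rw [ENNReal.lt_ofReal_iff_toReal_lt (kobayashiEDist_ne_top ho hc x y)]
    exact lt_add_one _
  obtain ⟨T, hchain, hT⟩ := exists_discChain_of_kobayashiEDist_lt hε hlt
  obtain ⟨N, p, S, h, h0, hN, rfl⟩ := hchain.exists_isDiscSeq hε.le
  exact ⟨N, p, S, h, Subtype.ext h0, Subtype.ext hN,
    (ENNReal.ofReal_lt_ofReal_iff_of_nonneg hchain.nonneg).1 hT⟩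

theorem IsDiscSeq.kobayashiDist_le {ε : ℝ} {p : ℕ → Ω} {S : ℕ → ℝ} (h : IsDiscSeq Ω ε p S)
    {i j : ℕ} (hij : i ≤ j) : kobayashiDist Ω (p i) (p j) ≤ S j - S i := by
  have hle := KobayashiLE.sum (p := fun k => (p (i + k) : EuclideanSpace ℂ (Fin n)))
    (c := fun k => S (i + (k + 1)) - S (i + k)) (N := j - i) (p i).2
    fun k _ => (h (i + k)).1.kobayashiLE
  rw [Finset.sum_range_sub (fun k => S (i + k)), Nat.add_sub_cancel' hij] at hle
  exact hle.kobayashiDist_le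

end Kobayashi

/-! ### Levi discs -/

section Taylor

variable {V : Type*} [NormedAddCommGroup V] [NormedSpace ℝ V] {f : V → ℝ}

theorem abs_sub_sub_fderiv_sub_le {B : V →L[ℝ] V →L[ℝ] ℝ} {z h : V} {η : ℝ}
    (hf : ∀ τ ∈ Icc (0 : ℝ) 1, DifferentiableAt ℝ f (z + τ • h))
    (hB : ∀ τ ∈ Icc (0 : ℝ) 1,
      ‖fderiv ℝ f (z + τ • h) - fderiv ℝ f z - B (τ • h)‖ ≤ η * ‖h‖) :
    |f (z + h) - f z - fderiv ℝ f z h - B h h / 2| ≤ η * ‖h‖ ^ 2 := by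
  have hderiv : ∀ τ ∈ Icc (0 : ℝ) 1, HasDerivWithinAt
      (fun τ : ℝ => f (z + τ • h) - τ * fderiv ℝ f z h - τ ^ 2 * (B h h / 2))
      ((fderiv ℝ f (z + τ • h) - fderiv ℝ f z - B (τ • h)) h) (Icc 0 1) τ := by
    intro τ hτ
    have hline : HasDerivAt (fun τ : ℝ => z + τ • h) h τ := by
      simpa using ((hasDerivAt_id τ).smul_const h).const_add z
    refine ((((hf τ hτ).hasFDerivAt.comp_hasDerivAt τ hline).sub
      ((hasDerivAt_id τ).mul_const (fderiv ℝ f z h))).sub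
      ((hasDerivAt_pow 2 τ).mul_const (B h h / 2))).hasDerivWithinAt.congr_deriv ?_
    simp only [sub_apply, map_smul, smul_apply, smul_eq_mul]
    push_cast
    ring
  have hbound : ∀ τ ∈ Ico (0 : ℝ) 1,
      ‖(fderiv ℝ f (z + τ • h) - fderiv ℝ f z - B (τ • h)) h‖ ≤ η * ‖h‖ ^ 2 := fun τ hτ => by
    rw [pow_two, ← mul_assoc]
    exact ContinuousLinearMap.le_of_opNorm_le _ (hB τ (Ico_subset_Icc_self hτ)) h
  have hmv := norm_image_sub_le_of_norm_deriv_le_segment_01' hderiv hbound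
  simp only [one_smul, zero_smul, add_zero, Real.norm_eq_abs] at hmv
  convert hmv using 2
  ring

theorem isLittleO_second_order_taylor {p : V} (hf : ContDiffAt ℝ 2 f p) :
    (fun q : V × V => f (q.1 + q.2) - f q.1 - fderiv ℝ f q.1 q.2 -
      fderiv ℝ (fderiv ℝ f) p q.2 q.2 / 2) =o[𝓝 (p, 0)] fun q => ‖q.2‖ ^ 2 := by
  have hstrict : HasStrictFDerivAt (fderiv ℝ f) (fderiv ℝ (fderiv ℝ f) p) p :=
    (hf.fderiv_right (m := 1) (by norm_num)).hasStrictFDerivAt one_ne_zero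
  have hdiff : ∀ᶠ z in 𝓝 p, DifferentiableAt ℝ f z :=
    (hf.eventually (by simp)).mono fun z hz => hz.differentiableAt two_ne_zero
  refine Asymptotics.isLittleO_iff.2 fun η hη => ?_
  obtain ⟨ρ, hρ, hball⟩ := Metric.eventually_nhds_iff_ball.1
    ((hstrict.isLittleO.def hη).and (hdiff.prod_nhds hdiff))
  have hadd : Tendsto (fun q : V × V => q.1 + q.2) (𝓝 (p, 0)) (𝓝 p) := by
    simpa using (continuous_add (M := V)).tendsto (p, 0)
  filter_upwards [hadd (ball_mem_nhds p hρ), continuous_fst.tendsto (p, 0) (ball_mem_nhds p hρ)]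
    with q hq hq₁
  have hseg : ∀ τ ∈ Icc (0 : ℝ) 1, (q.1 + τ • q.2, q.1) ∈ ball (p, p) ρ := fun τ hτ => by
    rw [← ball_prod_same]
    exact ⟨(convex_ball p ρ).add_smul_mem hq₁ hq hτ, hq₁⟩
  rw [norm_pow, norm_norm]
  refine abs_sub_sub_fderiv_sub_le (fun τ hτ => (hball _ (hseg τ hτ)).2.1) fun τ hτ => ?_
  have hτ' := (hball _ (hseg τ hτ)).1
  simp only [add_sub_cancel_left] at hτ'
  refine hτ'.trans ?_
  rw [norm_smul, Real.norm_of_nonneg hτ.1]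
  have := mul_le_of_le_one_left (norm_nonneg q.2) hτ.2
  gcongr

theorem isLittleO_bilinear_apply_self_sub {α F : Type*} [NormedAddCommGroup F] {l : Filter α}
    (B : V →L[ℝ] V →L[ℝ] ℝ)
    {g h : α → V} {t : α → F} (hg : (fun a => h a - g a) =o[l] t) (hh : h =O[l] t) :
    (fun a => B (h a) (h a) - B (g a) (g a)) =o[l] fun a => ‖t a‖ ^ 2 := by
  have hgO : g =O[l] t := by simpa using hh.sub hg.isBigO
  have h1 : (fun a => B (h a) (h a - g a)) =o[l] fun a => ‖t a‖ * ‖t a‖ :=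
    (B.isBoundedBilinearMap.isBigO_comp).trans_isLittleO (hh.norm_norm.mul_isLittleO hg.norm_norm)
  have h2 : (fun a => B (h a - g a) (g a)) =o[l] fun a => ‖t a‖ * ‖t a‖ :=
    (B.isBoundedBilinearMap.isBigO_comp).trans_isLittleO (hg.norm_norm.mul_isBigO hgO.norm_norm)
  refine (h1.add h2).congr (fun a => ?_) fun a => (pow_two _).symm
  simp only [map_sub, sub_apply]
  ring

end Taylor

section ComplexTangent

variable {V : Type*} [NormedAddCommGroup V] [NormedSpace ℂ V] [NormedSpace ℝ V]
  [IsScalarTower ℝ ℂ V]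

theorem exists_forall_apply_smul_eq_re {L : V →L[ℝ] ℝ} (hL : L ≠ 0) :
    ∃ N, ∀ w : ℂ, L (w • N) = w.re := by
  obtain ⟨v, hv⟩ := ContinuousLinearMap.exists_ne_zero hL
  set ℓ : StrongDual ℂ V := StrongDual.extendRCLike L
  have hre : ∀ u, (ℓ u).re = L u := fun u => StrongDual.re_extendRCLike_apply (𝕜 := ℂ) L u
  have hℓv : ℓ v ≠ 0 := fun h => hv (by rw [← hre, h, Complex.zero_re])
  exact ⟨(ℓ v)⁻¹ • v, fun w => by
    rw [← hre, map_smul, map_smul, smul_eq_mul, smul_eq_mul, inv_mul_cancel₀ hℓv, mul_one]⟩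

theorem exists_tendsto_forall_apply_smul_eq_zero {α : Type*} {l : Filter α} {L : α → V →L[ℝ] ℝ}
    {L₀ : V →L[ℝ] ℝ} {X : V} (hL : Tendsto L l (𝓝 L₀)) (hL₀ : L₀ ≠ 0)
    (hX : L₀ X = 0) (hIX : L₀ (Complex.I • X) = 0) :
    ∃ Y : α → V, Tendsto Y l (𝓝 X) ∧ ∀ᶠ a in l, ∀ t : ℂ, L a (t • Y a) = 0 := by
  obtain ⟨N, hN⟩ := exists_forall_apply_smul_eq_re hL₀
  let ℓ : (V →L[ℝ] ℝ) → StrongDual ℂ V := StrongDual.extendRCLike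
  have hℓ : ∀ M v, ℓ M v = M v - Complex.I * M (Complex.I • v) := fun M v =>
    StrongDual.extendRCLike_apply (𝕜 := ℂ) M v
  have hℓ_tendsto : ∀ v, Tendsto (fun a => ℓ (L a) v) l (𝓝 (ℓ L₀ v)) := fun v => by
    have happly : ∀ u, Tendsto (fun a => (L a u : ℂ)) l (𝓝 (L₀ u)) := fun u =>
      (Complex.continuous_ofReal.tendsto _).comp 
        (((ContinuousLinearMap.apply ℝ ℝ u).continuous.tendsto L₀).comp hL)
    simpa only [hℓ] using (happly v).sub ((happly _).const_mul Complex.I)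
  have hℓX : ℓ L₀ X = 0 := by rw [hℓ, hX, hIX]; simp
  have hℓN : ℓ L₀ N = 1 := by
    have h1 := hN 1
    rw [one_smul] at h1
    rw [hℓ, h1, hN]
    simp
  have hcoef : Tendsto (fun a => ℓ (L a) X / ℓ (L a) N) l (𝓝 0) := by
    have hdiv := (hℓ_tendsto X).div (hℓ_tendsto N) (by simp [hℓN])
    rwa [hℓX, zero_div] at hdiv
  refine ⟨fun a => X - (ℓ (L a) X / ℓ (L a) N) • N, ?_, ?_⟩
  · simpa using tendsto_const_nhds.sub (hcoef.smul_const N)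
  · filter_upwards [(hℓ_tendsto N).eventually_ne (by simp [hℓN] : ℓ L₀ N ≠ 0)] with a ha t
    rw [← StrongDual.re_extendRCLike_apply (𝕜 := ℂ) (L a)]
    change (ℓ (L a) _).re = 0
    rw [map_smul, map_sub, map_smul, smul_eq_mul, smul_eq_mul, div_mul_cancel₀ _ ha, sub_self,
      mul_zero, Complex.zero_re]

-- The quadratic form splits into its mean over the circle and the real part of a multiple of `t²`,
-- and the latter is cancelled by the linear term.
theorem exists_forall_apply_sq_smul_add {L : V →L[ℝ] ℝ} (hL : L ≠ 0)
    (B : V →L[ℝ] V →L[ℝ] ℝ) (X : V) :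
    ∃ c, ∀ t : ℂ, L (t ^ 2 • c) + B (t • X) (t • X) / 2 =
      (B X X + B (Complex.I • X) (Complex.I • X)) / 4 * ‖t‖ ^ 2 := by
  obtain ⟨N, hN⟩ := exists_forall_apply_smul_eq_re hL
  refine ⟨(⟨-(B X X - B (Complex.I • X) (Complex.I • X)) / 4,
    (B X (Complex.I • X) + B (Complex.I • X) X) / 4⟩ : ℂ) • N, fun t => ?_⟩
  have ht : t • X = t.re • X + t.im • (Complex.I • X) := by
    conv_lhs => rw [← Complex.re_add_im t, add_smul, mul_smul, ← Complex.coe_algebraMap,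
      algebraMap_smul, algebraMap_smul]
  rw [smul_smul, hN, ht, ← Complex.normSq_eq_norm_sq, Complex.normSq_apply]
  simp only [map_add, map_smul, add_apply, smul_apply, smul_eq_mul, pow_two, Complex.mul_re,
    Complex.mul_im]
  ring

end ComplexTangent

section QuadraticDisc

/-- The quadratic curve `t ↦ z + t v + t² c`. Analytic discs in the complement of `D` are taken of
this form: `v` is complex tangent to the level set of a defining function through `z`, and `c`
compensates the pluriharmonic part of its second order expansion. -/
def quadraticDisc {V : Type*} [AddCommGroup V] [Module ℂ V] (z v c : V) (t : ℂ) : V :=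
  z + t • v + t ^ 2 • c

variable {V : Type*} [NormedAddCommGroup V] [NormedSpace ℂ V]

theorem quadraticDisc_zero (z v c : V) : quadraticDisc z v c 0 = z := by
  simp [quadraticDisc]

theorem quadraticDisc_smul_smul (z v c : V) (ε t : ℂ) :
    quadraticDisc z (ε • v) (ε ^ 2 • c) t = quadraticDisc z v c (ε * t) := by
  simp only [quadraticDisc, smul_smul, mul_pow, mul_comm]

theorem differentiable_quadraticDisc (z v c : V) : Differentiable ℂ (quadraticDisc z v c) := by
  unfold quadraticDisc
  fun_prop

theorem tendsto_quadraticDisc {Y : V → V} {p X : V} (hY : Tendsto Y (𝓝 p) (𝓝 X)) (c : V) :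
    Tendsto (fun q : V × ℂ => quadraticDisc q.1 (Y q.1) c q.2) (𝓝 (p, 0)) (𝓝 p) := by
  have ht : Tendsto (fun q : V × ℂ => q.2) (𝓝 (p, 0)) (𝓝 0) := continuous_snd.tendsto (p, 0)
  have hz : Tendsto (fun q : V × ℂ => q.1) (𝓝 (p, 0)) (𝓝 p) := continuous_fst.tendsto (p, 0)
  simpa [quadraticDisc] using (hz.add (ht.smul (hY.comp hz))).add ((ht.pow 2).smul_const c)

theorem isLittleO_quadraticDisc_sub_sub {Y : V → V} {p X : V} (hY : Tendsto Y (𝓝 p) (𝓝 X))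
    (c : V) : (fun q : V × ℂ => quadraticDisc q.1 (Y q.1) c q.2 - q.1 - q.2 • X)
      =o[𝓝 (p, 0)] fun q => q.2 := by
  have hdir : Tendsto (fun q : V × ℂ => Y q.1 - X + q.2 • c) (𝓝 (p, 0)) (𝓝 0) := by
    simpa using ((hY.comp (continuous_fst.tendsto (p, (0 : ℂ)))).sub_const X).add
      ((continuous_snd.tendsto (p, (0 : ℂ))).smul_const c)
  refine ((Asymptotics.isBigO_refl (fun q : V × ℂ => q.2) _).smul_isLittleO
    ((Asymptotics.isLittleO_one_iff ℂ).2 hdir)).congr (fun q => ?_) fun q => mul_one q.2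
  simp only [quadraticDisc, smul_add, smul_sub, smul_smul, pow_two]
  abel

variable [NormedSpace ℝ V] [IsScalarTower ℝ ℂ V] {r : V → ℝ} {p X : V}

theorem exists_isLittleO_quadraticDisc (hr : ContDiffAt ℝ 2 r p) (hdr : fderiv ℝ r p ≠ 0)
    (hX : fderiv ℝ r p X = 0) (hIX : fderiv ℝ r p (Complex.I • X) = 0) :
    ∃ (c : V) (Y : V → V), Tendsto Y (𝓝 p) (𝓝 X) ∧
      (fun q : V × ℂ => r (quadraticDisc q.1 (Y q.1) c q.2) - r q.1 -
        (fderiv ℝ (fderiv ℝ r) p X X +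
          fderiv ℝ (fderiv ℝ r) p (Complex.I • X) (Complex.I • X)) / 4 * ‖q.2‖ ^ 2)
        =o[𝓝 (p, 0)] fun q => ‖q.2‖ ^ 2 := by
  have hdr_tendsto : Tendsto (fderiv ℝ r) (𝓝 p) (𝓝 (fderiv ℝ r p)) :=
    (hr.fderiv_right (m := 1) (by norm_num)).continuousAt
  set B := fderiv ℝ (fderiv ℝ r) p
  obtain ⟨Y, hY, hYtan⟩ := exists_tendsto_forall_apply_smul_eq_zero hdr_tendsto hdr hX hIX
  obtain ⟨c, hc⟩ := exists_forall_apply_sq_smul_add hdr B X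
  refine ⟨c, Y, hY, ?_⟩
  have hfst : Tendsto (fun q : V × ℂ => q.1) (𝓝 (p, 0)) (𝓝 p) := continuous_fst.tendsto (p, 0)
  let h : V × ℂ → V := fun q => quadraticDisc q.1 (Y q.1) c q.2 - q.1
  have hhX : (fun q => h q - q.2 • X) =o[𝓝 (p, 0)] fun q : V × ℂ => q.2 :=
    isLittleO_quadraticDisc_sub_sub hY c
  have hhO : h =O[𝓝 (p, 0)] fun q => q.2 := by
    simpa using hhX.isBigO.add (Asymptotics.IsBigO.of_bound ‖X‖
      (.of_forall fun q : V × ℂ => (by rw [norm_smul, mul_comm] : ‖q.2 • X‖ ≤ ‖X‖ * ‖q.2‖)))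
  have htaylor : (fun q : V × ℂ => r (q.1 + h q) - r q.1 - fderiv ℝ r q.1 (h q) -
      B (h q) (h q) / 2) =o[𝓝 (p, 0)] fun q => ‖q.2‖ ^ 2 := by
    have hh0 : Tendsto (fun q => (q.1, h q)) (𝓝 (p, 0)) (𝓝 (p, 0)) :=
      hfst.prodMk_nhds (by simpa using (tendsto_quadraticDisc hY c).sub hfst)
    exact ((isLittleO_second_order_taylor hr).comp_tendsto hh0).trans_isBigO
      (hhO.norm_norm.pow 2)
  have hlin : (fun q : V × ℂ => (fderiv ℝ r q.1 - fderiv ℝ r p) (q.2 ^ 2 • c)) =o[𝓝 (p, 0)]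
      fun q => ‖q.2‖ ^ 2 := by
    have hdr_o : (fun q : V × ℂ => fderiv ℝ r q.1 - fderiv ℝ r p) =o[𝓝 (p, 0)]
        fun _ => (1 : ℝ) :=
      (Asymptotics.isLittleO_one_iff ℝ).2 <| by
        simpa using (hdr_tendsto.comp hfst).sub_const (fderiv ℝ r p)
    have hc_O : (fun q : V × ℂ => q.2 ^ 2 • c) =O[𝓝 (p, 0)] fun q => ‖q.2‖ ^ 2 :=
      Asymptotics.IsBigO.of_bound ‖c‖ (.of_forall fun q => by simp [norm_smul, mul_comm])
    refine (isBoundedBilinearMap_apply.isBigO_comp.trans_isLittleO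
      (hdr_o.norm_norm.mul_isBigO hc_O.norm_norm)).congr_right fun q => ?_
    simp
  refine ((htaylor.add hlin).add
    ((isLittleO_bilinear_apply_self_sub B hhX hhO).const_mul_left (1 / 2))).congr' ?_ .rfl
  filter_upwards [hfst.eventually hYtan] with q hq
  have hh : fderiv ℝ r q.1 (h q) = fderiv ℝ r q.1 (q.2 ^ 2 • c) := by
    rw [show h q = q.2 • Y q.1 + q.2 ^ 2 • c by simp only [h, quadraticDisc]; abel, map_add, hq,
      zero_add]
  have hdisc : quadraticDisc q.1 (Y q.1) c q.2 = q.1 + h q := (add_sub_cancel _ _).symm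
  rw [hdisc, ← hc, hh, sub_apply]
  ring

theorem exists_eventually_add_mul_sq_le_quadraticDisc (hr : ContDiffAt ℝ 2 r p)
    (hdr : fderiv ℝ r p ≠ 0) (hX : fderiv ℝ r p X = 0) (hIX : fderiv ℝ r p (Complex.I • X) = 0)
    (hpos : 0 < fderiv ℝ (fderiv ℝ r) p X X +
      fderiv ℝ (fderiv ℝ r) p (Complex.I • X) (Complex.I • X)) :
    ∃ κ > 0, ∃ (c : V) (Y : V → V), Tendsto Y (𝓝 p) (𝓝 X) ∧
      ∀ᶠ q : V × ℂ in 𝓝 (p, 0),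
        r q.1 + κ * ‖q.2‖ ^ 2 ≤ r (quadraticDisc q.1 (Y q.1) c q.2) := by
  obtain ⟨c, Y, hY, hexp⟩ := exists_isLittleO_quadraticDisc hr hdr hX hIX
  set lam := fderiv ℝ (fderiv ℝ r) p X X + fderiv ℝ (fderiv ℝ r) p (Complex.I • X) (Complex.I • X)
  refine ⟨lam / 8, by positivity, c, Y, hY, ?_⟩
  filter_upwards [hexp.def (by positivity : 0 < lam / 8)] with q hq
  rw [norm_pow, norm_norm] at hq
  linarith [neg_le_of_abs_le hq]

theorem exists_eventually_exists_quadraticDisc (hr : ContDiffAt ℝ 2 r p)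
    (hdr : fderiv ℝ r p ≠ 0) (hX : fderiv ℝ r p X = 0) (hIX : fderiv ℝ r p (Complex.I • X) = 0)
    (hpos : 0 < fderiv ℝ (fderiv ℝ r) p X X +
      fderiv ℝ (fderiv ℝ r) p (Complex.I • X) (Complex.I • X)) (hX0 : X ≠ 0)
    {W : Set V} (hW : W ∈ 𝓝 p) :
    ∃ κ > 0, ∃ m > 0, ∃ c, ∀ᶠ z in 𝓝 p, ∃ v, m ≤ ‖v‖ ∧ ∀ t ∈ closedBall (0 : ℂ) 1,
      quadraticDisc z v c t ∈ W ∧ r z + κ * ‖t‖ ^ 2 ≤ r (quadraticDisc z v c t) := by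
  obtain ⟨κ, hκ, c, Y, hY, hrY⟩ :=
    exists_eventually_add_mul_sq_le_quadraticDisc hr hdr hX hIX hpos
  have hev := ((tendsto_quadraticDisc hY c).eventually_mem hW).and hrY
  rw [nhds_prod_eq] at hev
  obtain ⟨Pz, hPz, Pt, hPt, hP⟩ := eventually_prod_iff.1 hev
  obtain ⟨ε, hε, hεt⟩ := nhds_basis_closedBall.eventually_iff.1 hPt
  have hX0' : 0 < ‖X‖ := norm_pos_iff.2 hX0
  have hnorm : ‖(ε : ℂ)‖ = ε := by rw [Complex.norm_real, Real.norm_of_nonneg hε.le]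
  refine ⟨κ * ε ^ 2, by positivity, ε * (‖X‖ / 2), by positivity, (ε : ℂ) ^ 2 • c, ?_⟩
  filter_upwards [hPz, hY.norm.eventually_const_le (half_lt_self hX0')] with z hz hYz
  refine ⟨(ε : ℂ) • Y z, by rw [norm_smul, hnorm]; gcongr, fun t ht => ?_⟩
  have hεt' : (ε : ℂ) * t ∈ closedBall 0 ε := by
    rw [mem_closedBall_zero_iff] at ht ⊢
    rw [norm_mul, hnorm]
    exact mul_le_of_le_one_right hε.le ht
  obtain ⟨hmem, hle⟩ := hP hz (hεt hεt')
  rw [quadraticDisc_smul_smul, mul_assoc κ, ← mul_pow, ← hnorm, ← norm_mul, hnorm]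
  exact ⟨hmem, hle⟩

end QuadraticDisc

section Exterior

variable {n : ℕ} {D O : Set (EuclideanSpace ℂ (Fin n))} {p : EuclideanSpace ℂ (Fin n)}
  {r : EuclideanSpace ℂ (Fin n) → ℝ}

theorem re_leviForm_self (r : EuclideanSpace ℂ (Fin n) → ℝ) (p X : EuclideanSpace ℂ (Fin n)) :
    (leviForm r p X X).re = 1 / 4 * (fderiv ℝ (fderiv ℝ r) p X X +
      fderiv ℝ (fderiv ℝ r) p (Complex.I • X) (Complex.I • X)) := by
  simp [leviForm]

theorem IsC2LocalDefiningFunction.eventually_notMem_closure (h : IsC2LocalDefiningFunction D r p) :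
    ∀ᶠ z in 𝓝 p, 0 < r z → z ∉ closure D := by
  obtain ⟨U, hU, hpU, hr, -, hDU⟩ := h
  filter_upwards [hU.mem_nhds hpU] with z hz hrz hzD
  obtain ⟨w, ⟨hwU, hwr⟩, hwD⟩ := mem_closure_iff.1 hzD _
    (hr.continuousOn.isOpen_inter_preimage hU isOpen_Ioi) ⟨hz, hrz⟩
  exact lt_asymm (hDU.subset ⟨hwD, hwU⟩).2 hwr

theorem IsC2LocalDefiningFunction.eventually_nonneg (h : IsC2LocalDefiningFunction D r p) :
    ∀ᶠ z in 𝓝 p, z ∉ closure D → 0 ≤ r z := by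
  obtain ⟨U, hU, hpU, -, -, hDU⟩ := h
  filter_upwards [hU.mem_nhds hpU] with z hz hzD
  exact not_lt.1 fun hrz => hzD (subset_closure (hDU.superset ⟨hz, hrz⟩).1)

theorem IsC2LocalDefiningFunction.contDiffAt (h : IsC2LocalDefiningFunction D r p) :
    ContDiffAt ℝ 2 r p := by
  obtain ⟨U, hU, hpU, hr, -⟩ := h
  exact hr.contDiffAt (hU.mem_nhds hpU)

theorem IsC2LocalDefiningFunction.fderiv_ne_zero (h : IsC2LocalDefiningFunction D r p) :
    fderiv ℝ r p ≠ 0 := by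
  obtain ⟨-, -, -, -, hdr, -⟩ := h
  exact hdr

theorem LeviFormHasPositiveEigenvalue.exists_defining_function
    (h : LeviFormHasPositiveEigenvalue D p) :
    ∃ r, IsC2LocalDefiningFunction D r p ∧ ∃ X ∈ complexTangentSpace r p, X ≠ 0 ∧
      0 < fderiv ℝ (fderiv ℝ r) p X X +
        fderiv ℝ (fderiv ℝ r) p (Complex.I • X) (Complex.I • X) := by
  obtain ⟨r, hr, μ, hμ, X, hX, hX0, heig⟩ := h
  refine ⟨r, hr, X, hX, hX0, ?_⟩
  have hre : (leviForm r p X X).re = μ * ‖X‖ ^ 2 := by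
    rw [heig X hX, inner_self_eq_norm_sq_to_K, ← Complex.ofReal_re (μ * ‖X‖ ^ 2)]
    push_cast
    rfl
  have hpos : 0 < μ * ‖X‖ ^ 2 := by positivity
  rw [re_leviForm_self] at hre
  linarith

theorem LeviFormHasPositiveEigenvalue.exists_exterior_discs
    (h : LeviFormHasPositiveEigenvalue D p) (hO : O ∈ 𝓝 p) :
    ∃ m > 0, ∃ Q, IsCompact Q ∧ Q ⊆ O \ closure D ∧ ∀ᶠ z in 𝓝[(closure D)ᶜ] p, ∃ v c, m ≤ ‖v‖ ∧
      MapsTo (quadraticDisc z v c) (closedBall 0 1) (O \ closure D) ∧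
      quadraticDisc z v c (1 / 2) ∈ Q := by
  obtain ⟨r, hr, X, hX, hX0, hpos⟩ := h.exists_defining_function
  have hcont : ∀ᶠ z in 𝓝 p, ContinuousAt r z :=
    (hr.contDiffAt.eventually (by simp)).mono fun z hz => hz.continuousAt
  obtain ⟨R, hR, hball⟩ := nhds_basis_closedBall.eventually_iff.1
    ((eventually_mem_set.2 hO).and (hr.eventually_notMem_closure.and hcont))
  obtain ⟨κ, hκ, m, hm, c, hdisc⟩ := exists_eventually_exists_quadraticDisc hr.contDiffAt
    hr.fderiv_ne_zero hX.1 hX.2 hpos hX0 (closedBall_mem_nhds p hR)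
  refine ⟨m, hm, closedBall p R ∩ r ⁻¹' Ici (κ * (1 / 2) ^ 2), ?_, ?_, ?_⟩
  · exact (isCompact_closedBall p R).of_isClosed_subset
      (ContinuousOn.preimage_isClosed_of_isClosed
        (fun z hz => (hball hz).2.2.continuousWithinAt) isClosed_closedBall isClosed_Ici)
      inter_subset_left
  · exact fun z ⟨hz, hrz⟩ =>
      ⟨(hball hz).1, (hball hz).2.1 (lt_of_lt_of_le (by positivity) hrz)⟩
  rw [eventually_nhdsWithin_iff]
  filter_upwards [hdisc, hr.eventually_nonneg] with z ⟨v, hv, hz⟩ hz0 hzD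
  have hrz := hz0 hzD
  refine ⟨v, c, hv, fun t ht => ?_, ?_⟩
  · obtain ⟨hmem, hle⟩ := hz t ht
    refine ⟨(hball hmem).1, ?_⟩
    rcases eq_or_ne t 0 with rfl | ht0
    · rwa [quadraticDisc_zero]
    · have : 0 < κ * ‖t‖ ^ 2 := by positivity
      exact (hball hmem).2.1 (by linarith)
  · have hnorm : ‖(1 / 2 : ℂ)‖ = 1 / 2 := by norm_num
    obtain ⟨hmem, hle⟩ := hz (1 / 2) (by rw [mem_closedBall_zero_iff, hnorm]; norm_num)
    rw [hnorm] at hle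
    exact ⟨hmem, mem_preimage.2 (mem_Ici.2 (by linarith))⟩

end Exterior

/-! ### Connectedness of the complement -/

section Unicoherence

variable {X : Type*} [TopologicalSpace X]

theorem exists_continuousMap_addCircle_lift [SimplyConnectedSpace X] [LocallyPathConnectedSpace X]
    (f : C(X, AddCircle (1 : ℝ))) : ∃ θ : C(X, ℝ), ∀ x, (θ x : AddCircle (1 : ℝ)) = f x := by
  obtain ⟨x₀⟩ : Nonempty X := inferInstance
  obtain ⟨t₀, ht₀⟩ := QuotientAddGroup.mk_surjective (f x₀)
  obtain ⟨θ, ⟨-, hθ⟩, -⟩ :=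
    (AddCircle.isCoveringMap_coe (1 : ℝ)).existsUnique_continuousMap_lifts f x₀ t₀ ht₀
  exact ⟨θ, congrFun hθ⟩

theorem sub_eq_sub_of_forall_coe_addCircle_eq {S : Set X} (hS : IsPreconnected S) {θ g : X → ℝ}
    (hθ : ContinuousOn θ S) (hg : ContinuousOn g S)
    (h : ∀ x ∈ S, (θ x : AddCircle (1 : ℝ)) = g x) {a b : X} (ha : a ∈ S) (hb : b ∈ S) :
    θ a - g a = θ b - g b := by
  have hdiscrete : IsDiscrete (AddSubgroup.zmultiples (1 : ℝ) : Set ℝ) :=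
    ⟨inferInstanceAs (DiscreteTopology (AddSubgroup.zmultiples (1 : ℝ)))⟩
  exact hS.constant_of_mapsTo hdiscrete (hθ.sub hg)
    (fun x hx => QuotientAddGroup.eq_iff_sub_mem.1 (h x hx)) ha hb

-- A function `ψ` that is `0` off `V` and `1` off `U` induces a map to the circle, equal to `ψ` mod
-- `1` on `A` and to `0` elsewhere. Over `U` it lifts to `ψ 1_A`, over `V` to `(ψ - 1) 1_A`, and a
-- global lift differs from either by a constant.
theorem inter_subset_of_disjoint_frontier [SimplyConnectedSpace X] [LocallyPathConnectedSpace X]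
    [NormalSpace X] {U V A : Set X} (hUo : IsOpen U) (hVo : IsOpen V) (hU : IsPreconnected U)
    (hV : IsPreconnected V) (hUV : U ∪ V = univ) (hA : Disjoint (frontier A) (U ∩ V))
    (hne : (U ∩ V ∩ A).Nonempty) : U ∩ V ⊆ A := by
  classical
  obtain ⟨a, haUV, haA⟩ := hne
  intro b hbUV
  by_contra hbA
  obtain ⟨ψ, hψV, hψU, -⟩ := exists_continuous_zero_one_of_isClosed hVo.isClosed_compl
    hUo.isClosed_compl (disjoint_compl_left_iff_subset.2 fun x hxU =>
      (hUV.superset (mem_univ x)).resolve_left hxU)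
  have hψ_frontier : ∀ x ∈ frontier A, x ∈ Vᶜ ∨ x ∈ Uᶜ := fun x hx => by
    by_contra! h
    exact disjoint_left.1 hA hx ⟨not_not.1 h.2, not_not.1 h.1⟩
  let f : C(X, AddCircle (1 : ℝ)) := ⟨fun x => if x ∈ A then (ψ x : AddCircle (1 : ℝ)) else 0, by
    refine Continuous.if (fun x hx => ?_)
      ((AddCircle.continuous_mk' 1).comp ψ.continuous) continuous_const
    rcases hψ_frontier x hx with hxV | hxU
    · rw [hψV hxV, Pi.zero_apply, AddCircle.coe_zero]
    · rw [hψU hxU, Pi.one_apply, AddCircle.coe_period]⟩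
  obtain ⟨θ, hθ⟩ := exists_continuousMap_addCircle_lift f
  have hθU : θ a - ψ a = θ b - 0 := by
    have hg : ContinuousOn (fun x => if x ∈ A then ψ x else 0) U :=
      ContinuousOn.if (fun x hx => hψV ((hψ_frontier x hx.2).resolve_right (not_not.2 hx.1)))
        ψ.continuous.continuousOn continuousOn_const
    have hconst := sub_eq_sub_of_forall_coe_addCircle_eq hU θ.continuous.continuousOn hg
      (fun x _ => by rw [hθ]; simp only [f, ContinuousMap.coe_mk]; split_ifs <;> simp)
      haUV.1 hbUV.1
    rwa [if_pos haA, if_neg hbA] at hconst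
  have hθV : θ a - (ψ a - 1) = θ b - 0 := by
    have hg : ContinuousOn (fun x => if x ∈ A then ψ x - 1 else 0) V :=
      ContinuousOn.if (fun x hx => sub_eq_zero.2
        (hψU ((hψ_frontier x hx.2).resolve_left (not_not.2 hx.1))))
        (ψ.continuous.sub continuous_const).continuousOn continuousOn_const
    have hconst := sub_eq_sub_of_forall_coe_addCircle_eq hV θ.continuous.continuousOn hg
      (fun x _ => by
        rw [hθ]
        simp only [f, ContinuousMap.coe_mk]
        split_ifs <;> simp [AddCircle.coe_period])
      haUV.2 hbUV.2
    rwa [if_pos haA, if_neg hbA] at hconst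
  linarith

theorem disjoint_frontier_inter_of_subset_union {S u v : Set X} (hu : IsOpen u) (hv : IsOpen v)
    (hcov : S ⊆ u ∪ v) (hdisj : S ∩ (u ∩ v) = ∅) (hS : IsOpen S) :
    Disjoint (frontier (S ∩ u)) S := by
  refine disjoint_left.2 fun x hx hxS => ?_
  rw [(hS.inter hu).frontier_eq] at hx
  have hxv : x ∈ v := (hcov hxS).resolve_left fun hxu => hx.2 ⟨hxS, hxu⟩
  obtain ⟨y, hyv, hyS, hyu⟩ := mem_closure_iff.1 hx.1 v hv hxv
  exact hdisj.subset ⟨hyS, hyu, hyv⟩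

theorem isPreconnected_inter_of_union_eq_univ [SimplyConnectedSpace X]
    [LocallyPathConnectedSpace X] [NormalSpace X] {U V : Set X} (hUo : IsOpen U) (hVo : IsOpen V)
    (hU : IsPreconnected U) (hV : IsPreconnected V) (hUV : U ∪ V = univ) :
    IsPreconnected (U ∩ V) := by
  refine isPreconnected_iff_subset_of_disjoint.2 fun u v hu hv hcov hdisj => ?_
  rcases (U ∩ V ∩ u).eq_empty_or_nonempty with hempty | ⟨a, haUV, hau⟩
  · exact .inr fun x hx => (hcov hx).resolve_left fun hxu => hempty.subset ⟨hx, hxu⟩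
  · exact .inl ((inter_subset_of_disjoint_frontier hUo hVo hU hV hUV
      (disjoint_frontier_inter_of_subset_union hu hv hcov hdisj (hUo.inter hVo))
      ⟨a, haUV, haUV, hau⟩).trans inter_subset_right)

end Unicoherence

section UnboundedComponents

variable {V : Type*} [NormedAddCommGroup V] [NormedSpace ℝ V]

theorem isPreconnected_compl_closedBall_zero (hV : 1 < Module.rank ℝ V) {R : ℝ} (hR : 0 ≤ R) :
    IsPreconnected (closedBall (0 : V) R)ᶜ := by
  have himage : (closedBall (0 : V) R)ᶜ =
      (fun q : ℝ × V => q.1 • q.2) '' (Ioi R ×ˢ sphere 0 1) := by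
    ext y
    simp only [mem_compl_iff, mem_closedBall_zero_iff, not_le]
    constructor
    · intro hy
      have hy0 : ‖y‖ ≠ 0 := (hR.trans_lt hy).ne'
      refine ⟨(‖y‖, ‖y‖⁻¹ • y), ⟨hy, ?_⟩, smul_inv_smul₀ hy0 y⟩
      rw [mem_sphere_zero_iff_norm, norm_smul, norm_inv, norm_norm, inv_mul_cancel₀ hy0]
    · rintro ⟨⟨t, x⟩, ⟨ht, hx⟩, rfl⟩
      rw [mem_sphere_zero_iff_norm] at hx
      rw [norm_smul, hx, mul_one]
      exact lt_of_lt_of_le ht (le_abs_self t)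
  rw [himage]
  exact (isPreconnected_Ioi.prod (isPreconnected_sphere hV 0 1)).image _
    continuous_smul.continuousOn

theorem isPreconnected_of_forall_not_isBounded_connectedComponentIn (hV : 1 < Module.rank ℝ V)
    {S : Set V} (hS : Bornology.IsBounded Sᶜ)
    (h : ∀ z ∈ S, ¬ Bornology.IsBounded (connectedComponentIn S z)) : IsPreconnected S := by
  obtain ⟨R, hR0, hR⟩ := hS.subset_closedBall_lt 0 0
  have hmeet : ∀ z ∈ S, ∃ w ∈ connectedComponentIn S z, w ∈ (closedBall 0 R)ᶜ := fun z hz =>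
    not_subset.1 fun hzR => h z hz (isBounded_closedBall.subset hzR)
  refine isPreconnected_of_forall_pair fun x hx y hy => ?_
  obtain ⟨x', hx', hxR⟩ := hmeet x hx
  obtain ⟨y', hy', hyR⟩ := hmeet y hy
  refine ⟨connectedComponentIn S x ∪ (closedBall 0 R)ᶜ ∪ connectedComponentIn S y,
    union_subset (union_subset (connectedComponentIn_subset S x) (compl_subset_comm.1 hR))
      (connectedComponentIn_subset S y), .inl (.inl (mem_connectedComponentIn hx)),
    .inr (mem_connectedComponentIn hy), ?_⟩
  exact (isPreconnected_connectedComponentIn.union x' hx' hxR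
    (isPreconnected_compl_closedBall_zero hV hR0.le)).union y' (.inr hyR) hy'
    isPreconnected_connectedComponentIn

end UnboundedComponents

theorem disjoint_frontier_connectedComponentIn {X : Type*} [TopologicalSpace X]
    [LocallyConnectedSpace X] {U : Set X} (hU : IsOpen U) (x : X) :
    Disjoint (frontier (connectedComponentIn U x)) U := by
  refine disjoint_left.2 fun p hp hpU => ?_
  rw [hU.connectedComponentIn.frontier_eq] at hp
  obtain ⟨w, hwp, hwx⟩ := mem_closure_iff.1 hp.1 _ hU.connectedComponentIn
    (mem_connectedComponentIn hpU)
  refine hp.2 ?_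
  rw [connectedComponentIn_eq hwx, ← connectedComponentIn_eq hwp]
  exact mem_connectedComponentIn hpU

-- Averaging `‖z + t v + t² c‖²` over `t = ±1, ±i` gives `‖z‖² + ‖v‖² + ‖c‖²`.
theorem norm_sq_add_norm_sq_le_of_mapsTo_quadraticDisc {V : Type*} [NormedAddCommGroup V]
    [InnerProductSpace ℂ V] {z v c : V} {M : ℝ}
    (h : MapsTo (quadraticDisc z v c) (closedBall 0 1) (closedBall 0 M)) :
    ‖z‖ ^ 2 + ‖v‖ ^ 2 ≤ M ^ 2 := by
  have hsq : ∀ t : ℂ, ‖t‖ = 1 → ‖quadraticDisc z v c t‖ ^ 2 ≤ M ^ 2 := fun t ht =>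
    pow_le_pow_left₀ (norm_nonneg _)
      (mem_closedBall_zero_iff.1 (h (mem_closedBall_zero_iff.2 ht.le))) 2
  have h1 : ‖(z + c) + v‖ ^ 2 ≤ M ^ 2 := by
    have := hsq 1 (by simp)
    rwa [quadraticDisc, one_smul, one_pow, one_smul, add_right_comm] at this
  have h2 : ‖(z + c) - v‖ ^ 2 ≤ M ^ 2 := by
    have := hsq (-1) (by simp)
    rwa [quadraticDisc, neg_smul, one_smul, neg_sq, one_pow, one_smul, add_right_comm,
      ← sub_eq_add_neg] at this
  have h3 : ‖(z - c) + Complex.I • v‖ ^ 2 ≤ M ^ 2 := by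
    have := hsq Complex.I (by simp)
    rwa [quadraticDisc, Complex.I_sq, neg_one_smul, add_right_comm, ← sub_eq_add_neg] at this
  have h4 : ‖(z - c) - Complex.I • v‖ ^ 2 ≤ M ^ 2 := by
    have := hsq (-Complex.I) (by simp)
    rwa [quadraticDisc, neg_smul, neg_sq, Complex.I_sq, neg_one_smul, add_right_comm,
      ← sub_eq_add_neg, ← sub_eq_add_neg] at this
  have p1 := parallelogram_law_with_norm ℂ (z + c) v
  have p2 := parallelogram_law_with_norm ℂ (z - c) (Complex.I • v)
  have p3 := parallelogram_law_with_norm ℂ z c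
  rw [norm_smul, Complex.norm_I, one_mul] at p2
  nlinarith [sq_nonneg ‖c‖]

section

variable {n : ℕ} {D : Set (EuclideanSpace ℂ (Fin n))}

theorem exists_mem_frontier_forall_norm_le_of_isBounded_connectedComponentIn (hn : n ≠ 0)
    (hDo : IsOpen D) {z : EuclideanSpace ℂ (Fin n)} (hz : z ∈ (closure D)ᶜ)
    (hb : Bornology.IsBounded (connectedComponentIn (closure D)ᶜ z)) :
    ∃ p ∈ frontier D, p ∈ closure (connectedComponentIn (closure D)ᶜ z) ∧
      ∀ w ∈ connectedComponentIn (closure D)ᶜ z, ‖w‖ ≤ ‖p‖ := by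
  have : Nonempty (Fin n) := ⟨⟨0, Nat.pos_of_ne_zero hn⟩⟩
  set W := connectedComponentIn (closure D)ᶜ z
  obtain ⟨p, hp, hmax⟩ := Complex.exists_mem_frontier_isMaxOn_norm hb
    ⟨z, mem_connectedComponentIn hz⟩ (differentiable_id (𝕜 := ℂ)).diffContOnCl
  have hpD : p ∈ closure D := not_not.1 fun h =>
    disjoint_left.1 (disjoint_frontier_connectedComponentIn isClosed_closure.isOpen_compl z) hp h
  refine ⟨p, ?_, hp.1, fun w hw => hmax (subset_closure hw)⟩
  rw [hDo.frontier_eq]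
  refine ⟨hpD, fun h => ?_⟩
  obtain ⟨w, hwD, hwW⟩ := mem_closure_iff.1 hp.1 D hDo h
  exact connectedComponentIn_subset _ _ hwW (subset_closure hwD)

-- At the point of a bounded component that is farthest from the origin, the exterior discs, whose
-- size is bounded below, would contradict the mean value inequality for `‖·‖²`.
theorem not_isBounded_connectedComponentIn_compl_closure (hn : n ≠ 0) (hDo : IsOpen D)
    (hlevi : ∀ p ∈ frontier D, LeviFormHasPositiveEigenvalue D p)
    {z : EuclideanSpace ℂ (Fin n)} (hz : z ∈ (closure D)ᶜ) :
    ¬ Bornology.IsBounded (connectedComponentIn (closure D)ᶜ z) := by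
  intro hb
  obtain ⟨p, hpD, hpW, hmax⟩ :=
    exists_mem_frontier_forall_norm_le_of_isBounded_connectedComponentIn hn hDo hz hb
  obtain ⟨m, hm, Q, -, -, hdisc⟩ := (hlevi p hpD).exists_exterior_discs univ_mem
  have hnear : ∀ᶠ w in 𝓝 p, ‖p‖ ^ 2 - m ^ 2 < ‖w‖ ^ 2 :=
    (continuous_norm.pow 2).continuousAt.eventually_const_lt (sub_lt_self _ (by positivity))
  obtain ⟨w, hwW, hw, hwdisc⟩ := ((mem_closure_iff_frequently.1 hpW).and_eventually
    (hnear.and (eventually_nhdsWithin_iff.1 hdisc))).exists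
  obtain ⟨v, c, hmv, hmaps, -⟩ := hwdisc (connectedComponentIn_subset _ _ hwW)
  have hsub : quadraticDisc w v c '' closedBall 0 1 ⊆ connectedComponentIn (closure D)ᶜ z := by
    rw [connectedComponentIn_eq hwW]
    exact ((isConnected_closedBall zero_le_one).isPreconnected.image _
      (differentiable_quadraticDisc w v c).continuous.continuousOn).subset_connectedComponentIn
      ⟨0, by simp, quadraticDisc_zero w v c⟩ (image_subset_iff.2 fun t ht => (hmaps ht).2)
  have hle := norm_sq_add_norm_sq_le_of_mapsTo_quadraticDisc (M := ‖p‖) fun t ht =>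
    mem_closedBall_zero_iff.2 (hmax _ (hsub (mem_image_of_mem _ ht)))
  linarith [pow_le_pow_left₀ hm.le hmv 2]

theorem isPreconnected_compl_closure (hn : 2 ≤ n) (hDo : IsOpen D)
    (hDb : Bornology.IsBounded D) (hlevi : ∀ p ∈ frontier D, LeviFormHasPositiveEigenvalue D p) :
    IsPreconnected (closure D)ᶜ := by
  have hrank : 1 < Module.rank ℝ (EuclideanSpace ℂ (Fin n)) := by
    rw [← Module.finrank_eq_rank, finrank_real_of_complex, finrank_euclideanSpace_fin]
    exact_mod_cast (by omega : 1 < 2 * n)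
  refine isPreconnected_of_forall_not_isBounded_connectedComponentIn hrank
    (by rw [compl_compl]; exact hDb.closure) fun z hz =>
      not_isBounded_connectedComponentIn_compl_closure (by omega) hDo hlevi hz

theorem isConnected_diff_closure {G : Set (EuclideanSpace ℂ (Fin n))} (hn : 2 ≤ n)
    (hGo : IsOpen G) (hGc : IsConnected G) (hGb : Bornology.IsBounded G) (hDo : IsOpen D)
    (hDG : closure D ⊆ G) (hlevi : ∀ p ∈ frontier D, LeviFormHasPositiveEigenvalue D p) :
    IsConnected (G \ closure D) := by
  have : Nonempty (Fin n) := ⟨⟨0, by omega⟩⟩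
  refine ⟨?_, isPreconnected_inter_of_union_eq_univ hGo isClosed_closure.isOpen_compl
    hGc.isPreconnected (isPreconnected_compl_closure hn hDo (hGb.subset (subset_closure.trans hDG))
      hlevi) (eq_univ_of_forall fun x => (em (x ∈ closure D)).imp (@hDG x) id)⟩
  rw [sdiff_nonempty]
  intro hGD
  have hclopen : IsClopen G := ⟨(hGD.antisymm hDG) ▸ isClosed_closure, hGo⟩
  exact NormedSpace.unbounded_univ ℝ _ (hclopen.eq_univ hGc.nonempty ▸ hGb)

end

/-! ### Removing a set from a domain -/

section Diff

variable {n : ℕ} {G K L Ω : Set (EuclideanSpace ℂ (Fin n))} {a ρ ε C : ℝ} {o : G}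

theorem IsDiscStep.diff {x y : G} (h : IsDiscStep G (x : EuclideanSpace ℂ (Fin n)) y a)
    (hρ : 0 < ρ) (hK : ∀ q : G, (q : EuclideanSpace ℂ (Fin n)) ∈ K → ρ ≤ kobayashiDist G x q)
    (ha : Real.tanh a < Real.tanh ρ) :
    IsDiscStep (G \ K) (x : EuclideanSpace ℂ (Fin n)) y
      (Real.artanh (Real.tanh a / Real.tanh ρ)) := by
  obtain ⟨x, hx⟩ := x
  obtain ⟨y, hy⟩ := y
  obtain ⟨ha0, φ, hφ, hm, rfl, rfl⟩ := h
  have hr := tanh_pos_of_pos hρ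
  have hr1 := Real.tanh_lt_one ρ
  have hlt : ∀ ζ ∈ ball (0 : ℂ) 1, ‖((Real.tanh ρ : ℝ) : ℂ) * ζ‖ < Real.tanh ρ := by
    intro ζ hζ
    rw [norm_mul, norm_ofReal_tanh hρ.le]
    exact mul_lt_of_lt_one_right hr (mem_ball_zero_iff.1 hζ)
  have hscale : MapsTo (fun ζ : ℂ => ((Real.tanh ρ : ℝ) : ℂ) * ζ) (ball 0 1) (ball 0 1) :=
    fun ζ hζ => mem_ball_zero_iff.2 ((hlt ζ hζ).trans hr1)
  have hmK : MapsTo (fun ζ => φ (((Real.tanh ρ : ℝ) : ℂ) * ζ)) (ball 0 1) (G \ K) := by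
    refine fun ζ hζ => ⟨hm (hscale hζ), fun hq => ?_⟩
    have hdist := (isDiscStep_artanh hφ hm (hscale hζ)).kobayashiLE.kobayashiDist_le
      (x := ⟨_, hx⟩) (y := ⟨_, hm (hscale hζ)⟩)
    have hart : Real.artanh ‖((Real.tanh ρ : ℝ) : ℂ) * ζ‖ < ρ := by
      simpa only [Real.artanh_tanh] using Real.artanh_lt_artanh
        (neg_one_lt_zero.trans_le (norm_nonneg _)) hr1 (hlt ζ hζ)
    exact ((hK ⟨_, hm (hscale hζ)⟩ hq).trans hdist).not_gt hart
  have hτ := tanh_nonneg_of_nonneg ha0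
  have hα : ‖((Real.tanh a / Real.tanh ρ : ℝ) : ℂ)‖ = Real.tanh a / Real.tanh ρ :=
    Complex.norm_of_nonneg (by positivity)
  have hs := isDiscStep_artanh
    (hφ.comp ((differentiable_fun_id.const_mul _).differentiableOn) hscale) hmK
    (α := ((Real.tanh a / Real.tanh ρ : ℝ) : ℂ))
    (by rwa [mem_ball_zero_iff, hα, div_lt_one hr])
  rwa [hα, Function.comp_apply, Function.comp_apply, mul_zero, ← Complex.ofReal_mul,
    mul_div_cancel₀ _ hr.ne'] at hs

theorem IsDiscStep.kobayashiLE_diff {x y : G}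
    (h : IsDiscStep G (x : EuclideanSpace ℂ (Fin n)) y a) (hρ : 0 < ρ)
    (hK : ∀ q : G, (q : EuclideanSpace ℂ (Fin n)) ∈ K → ρ ≤ kobayashiDist G x q)
    (ha : Real.tanh a ≤ Real.tanh ρ / 2) :
    KobayashiLE (G \ K) (x : EuclideanSpace ℂ (Fin n)) y
      (a * (1 + 4 * ((Real.tanh ρ)⁻¹ - 1))) :=
  (h.diff hρ hK (ha.trans_lt (half_lt_self (tanh_pos_of_pos hρ)))).kobayashiLE.mono
    (artanh_tanh_div_tanh_le h.1 hρ ha)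

/-- Disc steps of `G` of length at most `ε` starting outside `L` can be carried out in `Ω` at a
cost that exceeds their length by a factor exponentially close to `1` in the distance from `o`. -/
def HasExpStepCost (G Ω L : Set (EuclideanSpace ℂ (Fin n))) (o : G) (ε C : ℝ) : Prop :=
  ∀ (x y : G) (a : ℝ), (x : EuclideanSpace ℂ (Fin n)) ∉ L →
    IsDiscStep G (x : EuclideanSpace ℂ (Fin n)) y a → a ≤ ε →
    KobayashiLE Ω (x : EuclideanSpace ℂ (Fin n)) y
      (a * (1 + C * Real.exp (-2 * kobayashiDist G o x)))

theorem exists_hasExpStepCost_diff (hGo : IsOpen G) (hGc : IsPreconnected G) {ρ₀ R : ℝ}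
    (hρ₀ : 0 < ρ₀)
    (hfar : ∀ x q : G, (x : EuclideanSpace ℂ (Fin n)) ∉ L →
      (q : EuclideanSpace ℂ (Fin n)) ∈ K → ρ₀ ≤ kobayashiDist G x q)
    (hR : ∀ q : G, (q : EuclideanSpace ℂ (Fin n)) ∈ K → kobayashiDist G o q ≤ R) :
    ∃ ε > 0, ∃ C ≥ 0, HasExpStepCost G (G \ K) L o ε C := by
  have hexp : 0 < 1 - Real.exp (-2 * ρ₀) := sub_pos.2 (Real.exp_lt_one_iff.2 (by linarith))
  refine ⟨Real.tanh ρ₀ / 2, half_pos (tanh_pos_of_pos hρ₀),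
    4 * (2 / (1 - Real.exp (-2 * ρ₀)) * Real.exp (2 * R)), by positivity, ?_⟩
  intro x y a hxL h ha
  set ρ := max ρ₀ (kobayashiDist G o x - R)
  have hρ₀ρ : ρ₀ ≤ ρ := le_max_left _ _
  have hK : ∀ q : G, (q : EuclideanSpace ℂ (Fin n)) ∈ K → ρ ≤ kobayashiDist G x q := by
    refine fun q hq => max_le (hfar x q hxL hq) ?_
    have htri := kobayashiDist_triangle hGo hGc o q x
    rw [kobayashiDist_comm q x] at htri
    linarith [hR q hq]
  have htanh : Real.tanh a ≤ Real.tanh ρ / 2 := by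
    linarith [tanh_le_self h.1, tanh_strictMono.monotone hρ₀ρ]
  refine (h.kobayashiLE_diff (hρ₀.trans_le hρ₀ρ) hK htanh).mono ?_
  have hexp_le : Real.exp (-2 * ρ) ≤ Real.exp (2 * R) * Real.exp (-2 * kobayashiDist G o x) := by
    rw [← Real.exp_add, Real.exp_le_exp]
    linarith [le_max_right ρ₀ (kobayashiDist G o x - R)]
  refine mul_le_mul_of_nonneg_left ?_ h.1
  rw [mul_assoc 4, mul_assoc (_ / _)]
  gcongr
  exact (inv_tanh_sub_one_le hρ₀ hρ₀ρ).trans (by gcongr)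

theorem sum_sub_mul_exp_le_one (S : ℕ → ℝ) (N : ℕ) :
    ∑ i ∈ Finset.range N, (S (i + 1) - S i) * Real.exp (-(S (i + 1) - S 0)) ≤ 1 := by
  have hterm : ∀ i, (S (i + 1) - S i) * Real.exp (-(S (i + 1) - S 0)) ≤
      Real.exp (-(S i - S 0)) - Real.exp (-(S (i + 1) - S 0)) := by
    intro i
    have hadd : Real.exp (-(S i - S 0)) =
        Real.exp (S (i + 1) - S i) * Real.exp (-(S (i + 1) - S 0)) := by
      rw [← Real.exp_add]
      congr 1
      ring
    rw [hadd, ← sub_one_mul]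
    exact mul_le_mul_of_nonneg_right (le_sub_iff_add_le.2 (Real.add_one_le_exp _))
      (Real.exp_nonneg _)
  refine (Finset.sum_le_sum fun i _ => hterm i).trans ?_
  rw [Finset.sum_range_sub' fun i => Real.exp (-(S i - S 0))]
  simp [Real.exp_nonneg]

theorem KobayashiLE.sum_exp {p : ℕ → EuclideanSpace ℂ (Fin n)} {S : ℕ → ℝ} {N : ℕ} (hC : 0 ≤ C)
    (h0 : p 0 ∈ Ω) (h : ∀ i < N, KobayashiLE Ω (p i) (p (i + 1))
      ((S (i + 1) - S i) * (1 + C * Real.exp (-(S (i + 1) - S 0))))) :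
    KobayashiLE Ω (p 0) (p N) (S N - S 0 + C) := by
  refine (KobayashiLE.sum h0 h).mono ?_
  have hsum : ∀ i, (S (i + 1) - S i) * (1 + C * Real.exp (-(S (i + 1) - S 0))) =
      (S (i + 1) - S i) + C * ((S (i + 1) - S i) * Real.exp (-(S (i + 1) - S 0))) :=
    fun i => by ring
  simp only [hsum, Finset.sum_add_distrib, ← Finset.mul_sum, Finset.sum_range_sub]
  gcongr
  exact mul_le_of_le_one_right hC (sum_sub_mul_exp_le_one S N)

theorem exists_middle_segment (P : ℕ → Prop) (κ : ℕ → ℝ) (N : ℕ) {R : ℝ}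
    (hR : ∀ i, P i → κ i ≤ R) :
    ∃ i₀ j₀, i₀ ≤ j₀ ∧ j₀ ≤ N ∧ (i₀ = j₀ ∨ P i₀ ∧ P j₀) ∧ (∀ i < i₀, ¬P i) ∧
      (∀ j, j₀ < j → j ≤ N → ¬P j) ∧ ∀ i ≤ N, κ i₀ ≤ max R (κ i) ∧ κ j₀ ≤ max R (κ i) := by
  classical
  by_cases hP : ∃ i, i ≤ N ∧ P i
  · have hlast : P (Nat.findGreatest P N) :=
      hP.elim fun i hi => Nat.findGreatest_spec hi.1 hi.2
    obtain ⟨hfirstN, hfirst⟩ := Nat.find_spec hP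
    refine ⟨Nat.find hP, Nat.findGreatest P N, Nat.le_findGreatest hfirstN hfirst,
      Nat.findGreatest_le N, .inr ⟨hfirst, hlast⟩, fun i hi hPi => ?_,
      fun j hj hjN => Nat.findGreatest_is_greatest hj hjN,
      fun i _ => ⟨le_max_of_le_left (hR _ hfirst), le_max_of_le_left (hR _ hlast)⟩⟩
    exact Nat.find_min hP hi ⟨hi.le.trans hfirstN, hPi⟩
  · push Not at hP
    obtain ⟨i₀, hi₀, hmin⟩ :=
      Finset.exists_min_image (Finset.range (N + 1)) κ Finset.nonempty_range_add_one
    rw [Finset.mem_range, Nat.lt_succ_iff] at hi₀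
    have hle : ∀ i ≤ N, κ i₀ ≤ max R (κ i) := fun i hi =>
      le_max_of_le_right (hmin i (Finset.mem_range.2 (Nat.lt_succ_of_le hi)))
    exact ⟨i₀, i₀, le_rfl, hi₀, .inl rfl, fun i hi => hP i (hi.le.trans hi₀),
      fun j _ hj => hP j hj, fun i hi => ⟨hle i hi, hle i hi⟩⟩

variable {p : ℕ → G} {S : ℕ → ℝ} {N : ℕ}

theorem IsDiscSeq.sub_le_kobayashiDist_add (h : IsDiscSeq G ε p S) (hGo : IsOpen G)
    (hGc : IsPreconnected G) (hlt : S N - S 0 < kobayashiDist G (p 0) (p N) + 1) (i : ℕ)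
    {j : ℕ} (hjN : j ≤ N) :
    S j - S i ≤ kobayashiDist G o (p i) + kobayashiDist G o (p j) + 1 := by
  have hsplit := kobayashiDist_triangle hGo hGc (p 0) (p i) (p N)
  have hsplit' := kobayashiDist_triangle hGo hGc (p i) (p j) (p N)
  have hthrough := kobayashiDist_triangle hGo hGc (p i) o (p j)
  rw [kobayashiDist_comm (p i) o] at hthrough
  linarith [h.kobayashiDist_le (Nat.zero_le i), h.kobayashiDist_le hjN]

theorem HasExpStepCost.kobayashiLE_of_growth (hcost : HasExpStepCost G Ω L o ε C) (hC : 0 ≤ C)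
    {b : ℝ} (h : IsDiscSeq G ε p S) (h0 : (p 0 : EuclideanSpace ℂ (Fin n)) ∈ Ω)
    (hout : ∀ i < N, (p (i + 1) : EuclideanSpace ℂ (Fin n)) ∉ L)
    (hgrow : ∀ i < N, S (i + 1) - S 0 ≤ 2 * kobayashiDist G o (p (i + 1)) + b) :
    KobayashiLE Ω (p 0 : EuclideanSpace ℂ (Fin n)) (p N) (S N - S 0 + C * Real.exp b) := by
  refine KobayashiLE.sum_exp (p := fun i => (p i : EuclideanSpace ℂ (Fin n))) (by positivity) h0
    fun i hi => ?_
  obtain ⟨hs, ha⟩ := h i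
  refine (hcost _ _ _ (hout i hi) hs.symm ha).symm.mono (mul_le_mul_of_nonneg_left ?_ hs.1)
  rw [mul_assoc, ← Real.exp_add]
  gcongr
  linarith [hgrow i hi]

theorem HasExpStepCost.kobayashiLE_of_near_geodesic (hcost : HasExpStepCost G Ω L o ε C)
    (hGo : IsOpen G) (hGc : IsPreconnected G) (hε : 0 ≤ ε) (hC : 0 ≤ C) {R M : ℝ} (hR : 0 ≤ R)
    (hL : ∀ x : G, (x : EuclideanSpace ℂ (Fin n)) ∈ L → kobayashiDist G o x ≤ R) (hM : 0 ≤ M)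
    (hmid : ∀ x ∈ L ∩ Ω, ∀ y ∈ L ∩ Ω, KobayashiLE Ω x y M)
    (h : IsDiscSeq G ε p S) (hlt : S N - S 0 < kobayashiDist G (p 0) (p N) + 1)
    (h0 : (p 0 : EuclideanSpace ℂ (Fin n)) ∈ Ω) (hN : (p N : EuclideanSpace ℂ (Fin n)) ∈ Ω) :
    KobayashiLE Ω (p 0 : EuclideanSpace ℂ (Fin n)) (p N)
      (S N - S 0 + (2 * (C * Real.exp (R + 1)) + M)) := by
  obtain ⟨i₀, j₀, hij, hjN, hmem, houti, houtj, hκ⟩ := exists_middle_segment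
    (fun i => (p i : EuclideanSpace ℂ (Fin n)) ∈ L) (fun i => kobayashiDist G o (p i)) N
    fun i => hL (p i)
  have hκ' : ∀ i ≤ N, kobayashiDist G o (p i₀) ≤ kobayashiDist G o (p i) + R ∧
      kobayashiDist G o (p j₀) ≤ kobayashiDist G o (p i) + R := fun i hi => by
    have hmax := max_le_add_of_nonneg hR (kobayashiDist_nonneg o (p i))
    constructor <;> linarith [hκ i hi]
  have hi₀ : (p i₀ : EuclideanSpace ℂ (Fin n)) ∈ Ω := by
    rcases i₀ with _ | i
    · exact h0
    · exact (hcost _ _ _ (houti i i.lt_succ_self) (h i).1 (h i).2).2.2.1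
  have hj₀ : (p j₀ : EuclideanSpace ℂ (Fin n)) ∈ Ω := by
    rcases hjN.eq_or_lt with rfl | hlt'
    · exact hN
    · exact (hcost _ _ _ (houtj _ j₀.lt_succ_self hlt') (h j₀).1.symm (h j₀).2).2.2.1
  have hmiddle : KobayashiLE Ω (p i₀ : EuclideanSpace ℂ (Fin n)) (p j₀) M := by
    rcases hmem with rfl | ⟨hi, hj⟩
    · exact (KobayashiLE.refl hi₀).mono hM
    · exact hmid _ ⟨hi, hi₀⟩ _ ⟨hj, hj₀⟩
  have hinit := hcost.kobayashiLE_of_growth hC (N := i₀) (b := R + 1) (h.reverse hε i₀) hi₀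
    (fun i hi => houti _ (by omega)) fun i hi => by
      have := h.sub_le_kobayashiDist_add (o := o) hGo hGc hlt (i₀ - (i + 1))
        (hij.trans hjN)
      rw [neg_sub_neg, Nat.sub_zero]
      linarith [(hκ' (i₀ - (i + 1)) (by omega)).1]
  have hfinal := hcost.kobayashiLE_of_growth hC (N := N - j₀) (b := R + 1) (h.shift j₀) hj₀
    (fun i hi => houtj _ (by omega) (by omega)) fun i hi => by
      have := h.sub_le_kobayashiDist_add (o := o) (j := j₀ + (i + 1)) hGo hGc hlt j₀
        (by omega)
      rw [add_zero]
      linarith [(hκ' (j₀ + (i + 1)) (by omega)).2]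
  simp only [Nat.sub_self, Nat.sub_zero] at hinit
  simp only [Nat.add_sub_cancel' hjN, add_zero] at hfinal
  exact ((hinit.symm.trans hmiddle).trans hfinal).mono (by linarith [h.monotone hij])

theorem exists_kobayashiDist_diff_le (hGo : IsOpen G) (hGc : IsPreconnected G)
    {ρ₀ : ℝ} (hρ₀ : 0 < ρ₀) {o' : EuclideanSpace ℂ (Fin n)} (hKL : K ⊆ L)
    (hfar : ∀ x q : G, (x : EuclideanSpace ℂ (Fin n)) ∉ L →
      (q : EuclideanSpace ℂ (Fin n)) ∈ K → ρ₀ ≤ kobayashiDist G x q)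
    (hL : IsKobayashiBounded G (o : EuclideanSpace ℂ (Fin n)) L)
    (hLK : IsKobayashiBounded (G \ K) o' (L ∩ (G \ K))) :
    ∃ M, ∀ z w : ↥(G \ K), kobayashiDist (G \ K) z w ≤
      kobayashiDist G (inclusion sdiff_subset z) (inclusion sdiff_subset w) + M := by
  obtain ⟨R, hR⟩ := hL
  obtain ⟨R', hR'⟩ := hLK
  have hLR : ∀ x : G, (x : EuclideanSpace ℂ (Fin n)) ∈ L → kobayashiDist G o x ≤ max R 0 :=
    fun x hx => le_max_of_le_left (hR x hx).kobayashiDist_le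
  obtain ⟨ε, hε, C, hC, hcost⟩ := exists_hasExpStepCost_diff hGo hGc hρ₀ hfar
    fun q hq => hLR q (hKL hq)
  refine ⟨2 * (C * Real.exp (max R 0 + 1)) + max (R' + R') 0 + 1, fun z w => ?_⟩
  obtain ⟨N, p, S, h, h0, hN, hlt⟩ :=
    exists_isDiscSeq_lt hε hGo hGc (inclusion sdiff_subset z) (inclusion sdiff_subset w)
  have hle := hcost.kobayashiLE_of_near_geodesic hGo hGc hε.le hC (le_max_right R 0) hLR
    (N := N) (le_max_right (R' + R') 0)
    (fun x hx y hy => ((hR' x hx).symm.trans (hR' y hy)).mono (le_max_left _ _)) h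
    (by rwa [h0, hN]) (by rw [h0]; exact z.2) (by rw [hN]; exact w.2)
  rw [h0, hN] at hle
  exact (KobayashiLE.kobayashiDist_le (x := z) (y := w) hle).trans (by linarith)

end Diff

/-! ### Points near the removed set -/

section DiffClosure

variable {n : ℕ} {G D L : Set (EuclideanSpace ℂ (Fin n))} {o p : EuclideanSpace ℂ (Fin n)}

theorem LeviFormHasPositiveEigenvalue.exists_nhds_isKobayashiBounded
    (h : LeviFormHasPositiveEigenvalue D p) (hGo : IsOpen G)
    (hc : IsPreconnected (G \ closure D)) (ho : o ∈ G \ closure D) (hp : p ∈ G) :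
    ∃ U ∈ 𝓝 p, IsKobayashiBounded (G \ closure D) o (U ∩ (closure D)ᶜ) := by
  obtain ⟨m, -, Q, hQ, hQs, hdisc⟩ := h.exists_exterior_discs (hGo.mem_nhds hp)
  obtain ⟨R, hR⟩ := isKobayashiBounded_of_isCompact (hGo.sdiff isClosed_closure) hc ho hQ hQs
  refine ⟨_, eventually_nhdsWithin_iff.1 hdisc, R + Real.artanh ‖(1 / 2 : ℂ)‖,
    fun z hz => ?_⟩
  obtain ⟨v, c, -, hm, hend⟩ := hz.1 hz.2
  have hstep := isDiscStep_artanh (differentiable_quadraticDisc z v c).differentiableOn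
    (hm.mono_left ball_subset_closedBall) (α := 1 / 2)
    (mem_ball_zero_iff.2 (by norm_num))
  rw [quadraticDisc_zero] at hstep
  exact (hR _ hend).trans hstep.symm.kobayashiLE

theorem isKobayashiBounded_inter_diff_closure (hGo : IsOpen G) (hDo : IsOpen D)
    (hc : IsPreconnected (G \ closure D))
    (hlevi : ∀ p ∈ frontier D, LeviFormHasPositiveEigenvalue D p) (ho : o ∈ G \ closure D)
    (hL : IsCompact L) (hLG : L ⊆ G) :
    IsKobayashiBounded (G \ closure D) o (L ∩ (G \ closure D)) := by
  have hbdd : IsKobayashiBounded (G \ closure D) o (L ∩ (closure D)ᶜ) := by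
    refine isKobayashiBounded_inter_of_isCompact hL fun p hp => ?_
    by_cases hpD : p ∈ D
    · exact ⟨D, hDo.mem_nhds hpD, 0, fun x hx => absurd (subset_closure hx.1) hx.2⟩
    by_cases hpc : p ∈ closure D
    · exact (hlevi p (hDo.frontier_eq ▸ ⟨hpc, hpD⟩)).exists_nhds_isKobayashiBounded hGo hc ho
        (hLG hp)
    · obtain ⟨U, hU, hb⟩ :=
        exists_nhds_isKobayashiBounded (hGo.sdiff isClosed_closure) hc ho ⟨hLG hp, hpc⟩
      exact ⟨U, hU, hb.mono inter_subset_left⟩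
  exact hbdd.mono (inter_subset_inter_right L fun x hx => hx.2)

theorem exists_kobayashiDist_diff_closure_le (hGo : IsOpen G) (hGc : IsPreconnected G)
    (hGb : Bornology.IsBounded G) (hDo : IsOpen D) (hDG : closure D ⊆ G)
    (hc : IsConnected (G \ closure D))
    (hlevi : ∀ p ∈ frontier D, LeviFormHasPositiveEigenvalue D p) :
    ∃ M, ∀ z w : ↥(G \ closure D), kobayashiDist (G \ closure D) z w ≤
      kobayashiDist G (inclusion sdiff_subset z) (inclusion sdiff_subset w) + M := by
  obtain ⟨o, ho⟩ := hc.nonempty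
  have hDc : IsCompact (closure D) := isCompact_of_isClosed_isBounded isClosed_closure
    (hGb.subset hDG)
  obtain ⟨r, hr, hrG⟩ := hDc.exists_cthickening_subset_open hGo hDG
  obtain ⟨c, hc0, hdist⟩ := exists_mul_dist_le_kobayashiDist hGo hGc hGb
  refine exists_kobayashiDist_diff_le (o := ⟨o, ho.1⟩) hGo hGc (mul_pos hc0 hr)
    (self_subset_cthickening (closure D)) (fun x q hx hq => ?_)
    (isKobayashiBounded_of_isCompact hGo hGc ho.1 hDc.cthickening hrG)
    (isKobayashiBounded_inter_diff_closure hGo hDo hc.isPreconnected hlevi ho hDc.cthickening hrG)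
  have hxq : r ≤ dist x q := le_of_not_ge fun hle =>
    hx (mem_cthickening_of_dist_le _ _ r _ hq hle)
  exact (by gcongr : c * r ≤ c * dist x q).trans (hdist x q)

end DiffClosure

/-! ### Quasi-isometry and hyperbolicity -/

theorem IsGromovHyperbolic.of_le_of_le_add {X Y : Type*} {d : X → X → ℝ} {e : Y → Y → ℝ}
    {f : X → Y} {M : ℝ} (h : IsGromovHyperbolic e) (h1 : ∀ x y, e (f x) (f y) ≤ d x y)
    (h2 : ∀ x y, d x y ≤ e (f x) (f y) + M) : IsGromovHyperbolic d := by
  obtain ⟨B, hB⟩ := h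
  refine ⟨B + 3 * M, fun p q x w => ?_⟩
  have hupper : ∀ a b, gromovProduct d a b w ≤ gromovProduct e (f a) (f b) (f w) + 2 * M := by
    intro a b
    unfold gromovProduct
    linarith [h1 a b, h2 a w, h2 w b]
  have hlower : gromovProduct e (f p) (f q) (f w) - M ≤ gromovProduct d p q w := by
    unfold gromovProduct
    linarith [h2 p q, h1 p w, h1 w q]
  have hmin : min (gromovProduct d p x w) (gromovProduct d x q w) ≤
      min (gromovProduct e (f p) (f x) (f w)) (gromovProduct e (f x) (f q) (f w)) + 2 * M := by
    rw [← min_add_add_right]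
    exact min_le_min (hupper p x) (hupper x q)
  have hdefect := hB (f p) (f q) (f x) (f w)
  unfold gromovDefect at hdefect ⊢
  linarith

theorem quasiIsometricallyEquivalent_of_le_of_le_add {X : Type*} {d e : X → X → ℝ} {M : ℝ}
    (h1 : ∀ x y, e x y ≤ d x y) (h2 : ∀ x y, d x y ≤ e x y + M) :
    QuasiIsometricallyEquivalent d e := by
  refine ⟨1, max M 1, one_pos, lt_max_of_lt_right one_pos, fun x y => ⟨?_, ?_⟩⟩
  · rw [inv_one, one_mul, sub_le_iff_le_add]
    exact (h2 x y).trans (add_le_add le_rfl (le_max_left M 1))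
  · rw [one_mul]
    exact (h1 x y).trans (le_add_of_nonneg_right (le_max_of_le_right zero_le_one))

theorem proposition5_general {n : ℕ} (hn : 2 ≤ n) {G D : Set (EuclideanSpace ℂ (Fin n))}
    (hG_open : IsOpen G) (hG_conn : IsConnected G) (hG_bdd : Bornology.IsBounded G)
    (hD_open : IsOpen D) (hDG : closure D ⊆ G)
    (hD_levi : ∀ p ∈ frontier D, LeviFormHasPositiveEigenvalue D p) :
    (IsOpen (G \ closure D) ∧ IsConnected (G \ closure D)) ∧
    (IsDistance (kobayashiDist G) ∧ IsDistance (kobayashiDist (G \ closure D))) ∧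
    QuasiIsometricallyEquivalent (kobayashiDist (G \ closure D))
      (fun z w : (G \ closure D : Set (EuclideanSpace ℂ (Fin n))) =>
        kobayashiDist G (Set.inclusion Set.sdiff_subset z) (Set.inclusion Set.sdiff_subset w)) ∧
    (IsGromovHyperbolic (kobayashiDist G) →
      IsGromovHyperbolic (kobayashiDist (G \ closure D))) := by
  have ho : IsOpen (G \ closure D) := hG_open.sdiff isClosed_closure
  have hc := isConnected_diff_closure hn hG_open hG_conn hG_bdd hD_open hDG hD_levi
  obtain ⟨M, hM⟩ := exists_kobayashiDist_diff_closure_le hG_open hG_conn.isPreconnected hG_bdd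
    hD_open hDG hc hD_levi
  have hle := kobayashiDist_inclusion_le ho hc.isPreconnected
    (sdiff_subset : G \ closure D ⊆ G)
  exact ⟨⟨ho, hc⟩, ⟨isDistance_kobayashiDist hG_open hG_conn.isPreconnected hG_bdd,
    isDistance_kobayashiDist ho hc.isPreconnected (hG_bdd.subset sdiff_subset)⟩,
    quasiIsometricallyEquivalent_of_le_of_le_add hle hM, fun h => h.of_le_of_le_add hle hM⟩

theorem proposition5 (n : ℕ) (hn : 2 ≤ n) (G D : Set (EuclideanSpace ℂ (Fin n)))
    (hG_open : IsOpen G) (hG_conn : IsConnected G) (hG_bdd : Bornology.IsBounded G)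
    (hD_open : IsOpen D) (hD_conn : IsConnected D)
    (hD_compact : IsCompact (closure D)) (hDG : closure D ⊆ G)
    (hD_smooth : HasC2Boundary D)
    (hD_levi : ∀ p ∈ frontier D, LeviFormHasPositiveEigenvalue D p) :
    (IsOpen (G \ closure D) ∧ IsConnected (G \ closure D)) ∧
    (IsDistance (kobayashiDist G) ∧ IsDistance (kobayashiDist (G \ closure D))) ∧
    QuasiIsometricallyEquivalent (kobayashiDist (G \ closure D))
      (fun z w : (G \ closure D : Set (EuclideanSpace ℂ (Fin n))) =>
        kobayashiDist G (Set.inclusion Set.sdiff_subset z) (Set.inclusion Set.sdiff_subset w)) ∧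
    (IsGromovHyperbolic (kobayashiDist G) →
      IsGromovHyperbolic (kobayashiDist (G \ closure D))) :=
  proposition5_general hn hG_open hG_conn hG_bdd hD_open hDG hD_levi
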